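/- Call a metrizable space $Z$ an AR (respectively ANR) if for every closed embedding $e\colon Z\to Y$ into a metrizable space $Y$ the image $e(Z)$ is a retract of $Y$ (respectively a retract of some open neighbourhood of $e(Z)$ in $Y$); an AR-compactum (respectively ANR-compactum) is a compact AR (respectively ANR). For a compact metrizable space $X$ let $P_f(X)$ be the set of all Borel probability measures $\mu$ on $X$ with finite support such that, if the support of $\mu$ consists of $n$ points, then one of these points has $\mu$-mass at least $1-\frac{1}{n+1}$; equip $P_f(X)$ with the topology of weak convergence of measures. **Theorem.** If $X$ is an AR-compactum or an ANR-compactum, then $P_f(X)$ is an ANR-compactum (that is, $P_f(X)$ is compact, metrizable and an absolute neighbourhood retract). -/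

import Mathlib

open MeasureTheory TopologicalSpace Topology

universe u

/-- `A` is a retract of `Y`: some continuous map `Y → A` fixes every point of `A`. -/
def IsRetract {Y : Type u} [TopologicalSpace Y] (A : Set Y) : Prop :=
  ∃ r : C(Y, A), ∀ a : A, r (a : Y) = a

/-- `A` is a neighbourhood retract of `Y`: some open set `U ⊇ A` of `Y` admits a continuous
map `U → A` that fixes every point of `A`. -/
def IsNeighborhoodRetract {Y : Type u} [TopologicalSpace Y] (A : Set Y) : Prop :=
  ∃ (U : Set Y) (_ : IsOpen U) (hAU : A ⊆ U) (r : C(U, A)), ∀ a : A, r ⟨a, hAU a.2⟩ = a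

/-- Absolute retracts (for metrizable spaces): metrizable spaces whose image under every closed
embedding into a metrizable space is a retract of that space. -/
def IsAR (X : Type u) [TopologicalSpace X] : Prop :=
  MetrizableSpace X ∧
    ∀ (Y : Type u) [TopologicalSpace Y] [MetrizableSpace Y] (e : X → Y),
      IsClosedEmbedding e → IsRetract (Set.range e)

/-- Absolute neighbourhood retracts (for metrizable spaces): metrizable spaces whose image under
every closed embedding into a metrizable space is a neighbourhood retract of that space. -/
def IsANR (X : Type u) [TopologicalSpace X] : Prop :=
  MetrizableSpace X ∧
    ∀ (Y : Type u) [TopologicalSpace Y] [MetrizableSpace Y] (e : X → Y),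
      IsClosedEmbedding e → IsNeighborhoodRetract (Set.range e)

/-- An AR-compactum: a compact absolute retract. -/
def IsARCompactum (X : Type u) [TopologicalSpace X] : Prop :=
  CompactSpace X ∧ IsAR X

/-- An ANR-compactum: a compact absolute neighbourhood retract. -/
def IsANRCompactum (X : Type u) [TopologicalSpace X] : Prop :=
  CompactSpace X ∧ IsANR X

/-- `P_f(X)`: the Borel probability measures on `X` with finite support such that, if the support
has `n` points, then one of these points has mass at least `1 - 1 / (n + 1)`. As a subset of
`ProbabilityMeasure X` it carries the topology of weak convergence. -/
def Pf (X : Type u) [TopologicalSpace X] [MeasurableSpace X] : Set (ProbabilityMeasure X) :=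
  {μ | (μ : Measure X).support.Finite ∧
    ∃ x ∈ (μ : Measure X).support,
      1 - 1 / (((μ : Measure X).support.ncard : ℝ) + 1) ≤ (μ : Measure X).real {x}}

/-!
Up to the embedding of `X` as a neighbourhood retract of the Hilbert cube `Cube`, everything is
about the cube, where atoms can be averaged and Tietze's theorem is available.

*Heavy points.* A measure `μ` in `Pf X` has one point `heavy μ` of mass at least `2 / 3`, and that
point depends continuously on `μ` (`continuousOn_heavy`). The mass condition says that the other
atoms, if there are `n - 1` of them, weigh at most `1 / (n + 1)` together. It survives any operation
that moves light atoms around, merges them, or shifts some of their mass to the heavy point, as none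
of these increases the number of atoms or decreases the mass of the heavy point
(`transport_mem`). Integrals against such a transported measure are integrals against the old one,
so continuity in parameters is immediate (`continuous_transport`).

*Compactness* (`isCompact_Pf`). Measures with a bounded number of atoms form a continuous image of a
compact set of positions and masses. Along an ultrafilter on which the number of atoms tends to
infinity, the mass of the heavy point tends to `1`, and the limit is a Dirac measure.

*The cube* (`isANE_Pf_cube`). In the language of neighbourhood extension (`IsANE`), which for
metrizable spaces is equivalent to being an ANR, the proof is a downward induction on `k` for the
measures with at least `k` atoms. By Hanner's theorem (`IsANE.of_locally`) it suffices to look near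
a measure `μ₀` with exactly `k` atoms. Put disjoint clusters around the light atoms of `μ₀`. A nearby
measure with at least `k` atoms charges every cluster, and `clusterDeformation` fades the light mass
outside of the clusters into the heavy point and then contracts each cluster to its barycenter. It
ends in the measures with at most `k` atoms, keeps those with exactly `k` atoms fixed, and never
leaves the measures with at least `k` atoms. The measures with exactly `k` atoms near `μ₀` have one
light atom per cluster, so they are parametrized by `k` points of the cube and `k - 1` masses, and
extend by Tietze's theorem (`isANE_clusterStratum`); those with more than `k` atoms are handled by
the induction hypothesis; the deformation glues the two (`IsANE.of_deformation`). The induction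
starts because the number of atoms is locally bounded away from the Dirac measures; Dirac measures
are the last stage `k = 1`, where there are no clusters.

*General `X`* (`isANR_Pf`). Let `R` retract a neighbourhood of `X` in the cube onto `X`. A map to
`Pf X` from a closed subset extends to a neighbourhood as a map to `Pf Cube`; fading the atoms far
from `X` into the heavy point and pushing the others by `R` brings it back to `Pf X`.
-/

section
open Set Filter

universe v

/-! ### Absolute neighbourhood extensors -/

/-- `f` (of which only the restriction to `A` matters) extends continuously to an open
neighbourhood of `A`, with values in `S`. -/
def HasNhdExtension {Y : Type u} [TopologicalSpace Y] {E : Type v} [TopologicalSpace E]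
    (f : Y → E) (A : Set Y) (S : Set E) : Prop :=
  ∃ U, IsOpen U ∧ A ⊆ U ∧ ∃ F : Y → E, ContinuousOn F U ∧ MapsTo F U S ∧ EqOn F f A

/-- The subset `S` is an absolute neighbourhood extensor for metrizable spaces (of the universe
`u`). Partial maps are encoded as total functions together with `ContinuousOn`. -/
def IsANE {E : Type v} [TopologicalSpace E] (S : Set E) : Prop :=
  ∀ (Y : Type u) [TopologicalSpace Y] [MetrizableSpace Y] (A : Set Y), IsClosed A →
    ∀ f : Y → E, ContinuousOn f A → MapsTo f A S → HasNhdExtension f A S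

variable {E : Type v} [TopologicalSpace E] {S : Set E}

theorem isANE_empty : IsANE.{u} (∅ : Set E) := by
  intro Y _ _ A hA f hf hfS
  refine ⟨∅, isOpen_empty, fun y hy => (hfS hy).elim, f, continuousOn_empty f, ?_, fun y _ => rfl⟩
  exact fun y hy => hy.elim

theorem HasNhdExtension.inter {Y : Type u} [TopologicalSpace Y] {f : Y → E} {A : Set Y}
    (h : HasNhdExtension f A S) {G : Set E} (hG : IsOpen G) (hf : MapsTo f A G) :
    HasNhdExtension f A (S ∩ G) := by
  obtain ⟨U, hU, hAU, F, hF, hFS, hFf⟩ := h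
  refine ⟨U ∩ F ⁻¹' G, hF.isOpen_inter_preimage hU hG, fun y hy => ⟨hAU hy, ?_⟩, F,
    hF.mono inter_subset_left, fun y hy => ⟨hFS hy.1, hy.2⟩, hFf⟩
  rw [mem_preimage, hFf hy]
  exact hf hy

theorem IsANE.inter_isOpen (h : IsANE.{u} S) {G : Set E} (hG : IsOpen G) :
    IsANE.{u} (S ∩ G) := fun Y _ _ A hA f hf hfS =>
  (h Y A hA f hf fun _ hy => (hfS hy).1).inter hG fun _ hy => (hfS hy).2

/-- Absolute neighbourhood extensors also extend maps given on a relatively closed subset `C ∩ W`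
of an open set `W`. -/
theorem IsANE.exists_extension_in_open (h : IsANE.{u} S) {Y : Type u} [TopologicalSpace Y]
    [MetrizableSpace Y] {W C : Set Y} (hW : IsOpen W) (hC : IsClosed C) {f : Y → E}
    (hf : ContinuousOn f (C ∩ W)) (hfS : MapsTo f (C ∩ W) S) :
    ∃ U, IsOpen U ∧ C ∩ W ⊆ U ∧ U ⊆ W ∧
      ∃ F : Y → E, ContinuousOn F U ∧ MapsTo F U S ∧ EqOn F f (C ∩ W) := by
  classical
  obtain ⟨U, hU, hAU, F, hF, hFS, hFf⟩ := h W (Subtype.val ⁻¹' C)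
    (hC.preimage continuous_subtype_val) (f ∘ Subtype.val)
    (hf.comp continuous_subtype_val.continuousOn fun y hy => ⟨hy, y.2⟩)
    fun y hy => hfS ⟨hy, y.2⟩
  have key : ∀ y : W, (fun y => if h : y ∈ W then F ⟨y, h⟩ else f y) (y : Y) = F y := by
    intro y
    simp [y.2]
  refine ⟨Subtype.val '' U, hW.isOpenEmbedding_subtypeVal.isOpenMap U hU,
    fun y hy => ⟨⟨y, hy.2⟩, hAU hy.1, rfl⟩, by rintro _ ⟨y, -, rfl⟩; exact y.2,
    fun y => if h : y ∈ W then F ⟨y, h⟩ else f y, ?_, ?_, ?_⟩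
  · rintro _ ⟨y, hy, rfl⟩
    refine ContinuousAt.continuousWithinAt ?_
    refine (hW.isOpenEmbedding_subtypeVal.continuousAt_iff (x := y)).1 ?_
    have : (fun y => if h : y ∈ W then F ⟨y, h⟩ else f y) ∘ Subtype.val = F := funext key
    rw [this]
    exact hF.continuousAt (hU.mem_nhds hy)
  · rintro _ ⟨y, hy, rfl⟩
    rw [key]
    exact hFS hy
  · intro y hy
    rw [key ⟨y, hy.2⟩]
    exact hFf (x := ⟨y, hy.2⟩) hy.1

/-! ### Being an absolute neighbourhood extensor is a local property -/

/-- Extension slab by slab: the space is cut along the level sets `g = 1, 2, …`; the map is first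
extended near `A` within each level set and then within each slab `m ≤ g ≤ m + 1`. -/
theorem HasNhdExtension.of_slabs {Y : Type u} [TopologicalSpace Y] [MetrizableSpace Y]
    {A : Set Y} (hA : IsClosed A) {f : Y → E} (hf : ContinuousOn f A) (hfS : MapsTo f A S)
    {g : Y → ℝ} (hg : Continuous g) (hg0 : ∀ y, 0 ≤ g y) {G : ℕ → Set E}
    (hG : ∀ m, IsOpen (G m)) (hS : ∀ m, IsANE.{u} (S ∩ G m))
    (hfG : ∀ m : ℕ, ∀ y ∈ A, m ≤ g y → g y ≤ m + 1 → f y ∈ G m) :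
    HasNhdExtension f A S := by
  classical
  let := metrizableSpaceMetric Y
  have h1 : ∀ m : ℕ, HasNhdExtension f (A ∩ {y | g y = m + 1}) (S ∩ G m ∩ G (m + 1)) := by
    intro m
    refine ((hS m).inter_isOpen (hG (m + 1))) Y _ (hA.inter (isClosed_eq hg continuous_const)) f
      (hf.mono inter_subset_left) ?_
    rintro y ⟨hy, hy' : g y = m + 1⟩
    refine ⟨⟨hfS hy, hfG m y hy (by linarith) (by linarith)⟩, hfG (m + 1) y hy ?_ ?_⟩
    · push_cast; linarith
    · push_cast; linarith
  choose U hU hAU F hF hFS hFf using h1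
  have h2 : ∀ m : ℕ, ∃ V, IsOpen V ∧ A ∩ {y | g y = m + 1} ⊆ V ∧ closure V ⊆ U m := fun m =>
    normal_exists_closure_subset (hA.inter (isClosed_eq hg continuous_const)) (hU m) (hAU m)
  choose V hV hAV hVU using h2
  -- `J m` is the part of the level set `g = m` over which the map has been extended.
  obtain ⟨J, hJ0, hJs⟩ : ∃ J : ℕ → Set Y, J 0 = ∅ ∧
      ∀ m : ℕ, J (m + 1) = closure (V m) ∩ {y | g y = m + 1} :=
    ⟨fun m => Nat.casesOn m ∅ fun m => closure (V m) ∩ {y | g y = m + 1}, rfl, fun m => rfl⟩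
  have hJc : ∀ m, IsClosed (J m) := by
    rintro (_ | m)
    · rw [hJ0]; exact isClosed_empty
    · rw [hJs]; exact isClosed_closure.inter (isClosed_eq hg continuous_const)
  set φ : Y → E := fun y => if y ∈ A then f y else F (⌊g y⌋₊ - 1) y with hφ
  have hφA : EqOn φ f A := fun y hy => by simp [hφ, hy]
  have hφJ : ∀ m, EqOn φ (F m) (J (m + 1)) := by
    intro m y hy
    rw [hJs] at hy
    have hgy : g y = m + 1 := hy.2
    by_cases hyA : y ∈ A
    · rw [hφA hyA, hFf m ⟨hyA, hgy⟩]
    · have : ⌊g y⌋₊ = m + 1 := by rw [hgy]; exact_mod_cast Nat.floor_natCast (R := ℝ) (m + 1)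
      simp [hφ, hyA, this]
  have hφJc : ∀ m, ContinuousOn φ (J m) ∧ ∀ k, (m = k ∨ m = k + 1) → MapsTo φ (J m) (S ∩ G k) := by
    rintro (_ | m)
    · rw [hJ0]
      exact ⟨continuousOn_empty _, fun k _ => mapsTo_empty _ _⟩
    · have hsub : J (m + 1) ⊆ U m := by rw [hJs]; exact inter_subset_left.trans (hVU m)
      refine ⟨((hF m).mono hsub).congr (hφJ m), fun k hk y hy => ?_⟩
      rw [hφJ m hy]
      have := hFS m (hsub hy)
      rcases hk with hk | hk
      · subst hk; exact ⟨this.1.1, this.2⟩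
      · obtain rfl : m = k := by omega
        exact this.1
  set B : ℕ → Set Y := fun m => (A ∩ {y | m ≤ g y ∧ g y ≤ m + 1}) ∪ (J m ∪ J (m + 1)) with hB
  have h3 : ∀ m : ℕ, HasNhdExtension φ (B m) (S ∩ G m) := by
    intro m
    have hc : IsClosed (A ∩ {y | (m : ℝ) ≤ g y ∧ g y ≤ m + 1}) :=
      hA.inter ((isClosed_le continuous_const hg).inter (isClosed_le hg continuous_const))
    refine hS m Y (B m) (hc.union ((hJc _).union (hJc _))) φ ?_ ?_
    · refine ContinuousOn.union_of_isClosed ?_ ?_ hc ((hJc _).union (hJc _))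
      · exact (hf.mono inter_subset_left).congr fun y hy => hφA hy.1
      · exact ContinuousOn.union_of_isClosed (hφJc _).1 (hφJc _).1 (hJc _) (hJc _)
    · rintro y (hy | hy | hy)
      · rw [hφA hy.1]
        exact ⟨hfS hy.1, hfG m y hy.1 hy.2.1 hy.2.2⟩
      · exact (hφJc m).2 m (Or.inl rfl) hy
      · exact (hφJc (m + 1)).2 m (Or.inr rfl) hy
  choose N hN hBN Φ hΦ hΦS hΦφ using h3
  set T : Set Y := {y | y ∈ N ⌊g y⌋₊ ∧ ∀ m : ℕ, g y = m + 1 → y ∈ J (m + 1) ∧ y ∈ N m} with hT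
  set H : Y → E := fun y => Φ ⌊g y⌋₊ y with hH
  have hopen : ∀ a b : ℝ, IsOpen {y | a < g y ∧ g y < b} := fun a b =>
    (isOpen_lt continuous_const hg).inter (isOpen_lt hg continuous_const)
  have hfloor : ∀ y, (⌊g y⌋₊ : ℝ) ≤ g y ∧ g y < ⌊g y⌋₊ + 1 := fun y =>
    ⟨Nat.floor_le (hg0 y), Nat.lt_floor_add_one _⟩
  -- A point is either interior to its slab, or on the level set below it, or on the level `0`.
  have hcases : ∀ y, (∀ᶠ z in 𝓝 y, ⌊g z⌋₊ = ⌊g y⌋₊ ∧ ∀ m : ℕ, g z ≠ m + 1) ∨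
      ∃ m : ℕ, g y = m + 1 ∧ ⌊g y⌋₊ = m + 1 ∧ ∀ᶠ z in 𝓝 y, m < g z ∧ g z < m + 2 := by
    intro y
    rcases (hfloor y).1.lt_or_eq with h | h
    · left
      filter_upwards [(hopen _ _).mem_nhds ⟨h, (hfloor y).2⟩] with z hz
      refine ⟨(Nat.floor_eq_iff (hg0 z)).2 ⟨hz.1.le, hz.2⟩, fun m hm => ?_⟩
      rw [hm] at hz
      have h1 : ⌊g y⌋₊ < m + 1 := by exact_mod_cast hz.1
      have h2 : m + 1 < ⌊g y⌋₊ + 1 := by exact_mod_cast hz.2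
      omega
    · rcases Nat.eq_zero_or_pos ⌊g y⌋₊ with h0 | h0
      · left
        have hgy : g y = 0 := by rw [← h, h0]; simp
        filter_upwards [(hopen (-1) 1).mem_nhds (x := y) (by
          constructor <;> rw [hgy] <;> norm_num)] with z hz
        refine ⟨?_, fun m hm => ?_⟩
        · rw [h0]; exact Nat.floor_eq_zero.2 hz.2
        · have : (0 : ℝ) ≤ m := m.cast_nonneg
          linarith [hz.2]
      · right
        obtain ⟨m, hm⟩ : ∃ m, ⌊g y⌋₊ = m + 1 := ⟨⌊g y⌋₊ - 1, by omega⟩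
        have hgy : g y = m + 1 := by rw [← h, hm]; push_cast; rfl
        refine ⟨m, hgy, hm, ?_⟩
        exact (hopen _ _).mem_nhds ⟨by linarith, by linarith⟩
  refine ⟨interior T, isOpen_interior, fun y hy => ?_, H, ?_, ?_, ?_⟩
  · rw [mem_interior_iff_mem_nhds]
    have hyB : y ∈ B ⌊g y⌋₊ := Or.inl ⟨hy, (hfloor y).1, (hfloor y).2.le⟩
    rcases hcases y with h | ⟨m, hgy, hm, h⟩
    · filter_upwards [h, (hN _).mem_nhds (hBN _ hyB)] with z hz hzN
      exact ⟨by rwa [hz.1], fun m hm => (hz.2 m hm).elim⟩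
    · have hyB' : y ∈ B m := Or.inl ⟨hy, by linarith, by linarith⟩
      filter_upwards [h, (hN _).mem_nhds (hBN _ hyB), (hN _).mem_nhds (hBN _ hyB'),
        (hV m).mem_nhds (hAV m ⟨hy, hgy⟩)] with z hz hzN hzN' hzV
      rw [hm] at hzN
      constructor
      · rcases lt_or_ge (g z) (m + 1) with h' | h'
        · rwa [(Nat.floor_eq_iff (hg0 z)).2 ⟨hz.1.le, h'⟩]
        · rwa [(Nat.floor_eq_iff (n := m + 1) (hg0 z)).2
            ⟨by push_cast; exact h', by push_cast; linarith [hz.2]⟩]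
      · intro k hk
        obtain rfl : k = m := by
          rw [hk] at hz
          have h1 : m < k + 1 := by exact_mod_cast hz.1
          have h2 : k + 1 < m + 2 := by exact_mod_cast hz.2
          omega
        exact ⟨by rw [hJs]; exact ⟨subset_closure hzV, hk⟩, hzN'⟩
  · intro y hy
    have hyT := interior_subset hy
    refine ContinuousAt.continuousWithinAt ?_
    rcases hcases y with h | ⟨m, hgy, hm, h⟩
    · refine ((hΦ _).continuousAt ((hN _).mem_nhds hyT.1)).congr ?_
      filter_upwards [h] with z hz
      simp [hH, hz.1]
    · obtain ⟨hyJ, hyN⟩ := hyT.2 m hgy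
      have e1 : Φ (m + 1) y = H y := by simp [hH, hm]
      have e2 : Φ m y = H y := by
        rw [← e1, hΦφ m (Or.inr (Or.inr hyJ)), hΦφ (m + 1) (Or.inr (Or.inl hyJ))]
      have c1 := (hΦ _).continuousAt ((hN (m + 1)).mem_nhds (hm ▸ hyT.1))
      have c2 := (hΦ _).continuousAt ((hN m).mem_nhds hyN)
      rw [ContinuousAt, e1] at c1
      rw [ContinuousAt, e2] at c2
      rw [ContinuousAt, tendsto_def]
      intro s hs
      filter_upwards [c1 hs, c2 hs, h] with z hz1 hz2 hz
      rcases lt_or_ge (g z) (m + 1) with h' | h'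
      · have : ⌊g z⌋₊ = m := (Nat.floor_eq_iff (hg0 z)).2 ⟨hz.1.le, h'⟩
        simpa [hH, this] using hz2
      · have : ⌊g z⌋₊ = m + 1 := (Nat.floor_eq_iff (hg0 z)).2
          ⟨by push_cast; exact h', by push_cast; linarith [hz.2]⟩
        simpa [hH, this] using hz1
  · intro y hy
    exact (hΦS _ (interior_subset hy).1).1
  · intro y hy
    change Φ ⌊g y⌋₊ y = f y
    rw [hΦφ _ (Or.inl ⟨hy, (hfloor y).1, (hfloor y).2.le⟩), hφA hy]

/-- A union of two relatively open absolute neighbourhood extensors is one. -/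
theorem IsANE.union_of_isOpen {G₀ G₁ : Set E} (hG₀ : IsOpen G₀) (hG₁ : IsOpen G₁)
    (h₀ : IsANE.{u} (S ∩ G₀)) (h₁ : IsANE.{u} (S ∩ G₁)) : IsANE.{u} (S ∩ (G₀ ∪ G₁)) := by
  intro Y _ _ A hA f hf hfS
  let := metrizableSpaceMetric Y
  obtain ⟨g, hg⟩ := exists_continuous_forall_mem_convex_of_local_const (X := Y) (E := ℝ)
    (t := fun y => {r | 0 ≤ r ∧ (y ∈ A → (r ≤ 1 → f y ∈ G₀) ∧ (1 ≤ r → f y ∈ G₁))})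
    (fun y => by
      refine OrdConnected.convex ⟨fun a ha b hb r hr => ⟨ha.1.trans hr.1, fun hy =>
        ⟨fun h => (ha.2 hy).1 (hr.1.trans h), fun h => (hb.2 hy).2 (h.trans hr.2)⟩⟩⟩)
    (fun y => by
      by_cases hy : y ∈ A
      · rcases (hfS hy).2 with h | h
        · have := (hf y hy).eventually (hG₀.mem_nhds h)
          rw [eventually_nhdsWithin_iff] at this
          refine ⟨0, this.mono fun z hz => ⟨le_rfl, fun hzA => ⟨fun _ => hz hzA, fun h => ?_⟩⟩⟩
          norm_num at h
        · have := (hf y hy).eventually (hG₁.mem_nhds h)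
          rw [eventually_nhdsWithin_iff] at this
          refine ⟨2, this.mono fun z hz =>
            ⟨zero_le_two, fun hzA => ⟨fun h => ?_, fun _ => hz hzA⟩⟩⟩
          norm_num at h
      · refine ⟨0, Filter.Eventually.mono (hA.isOpen_compl.mem_nhds hy) ?_⟩
        exact fun z hz => ⟨le_rfl, fun h => (hz h).elim⟩)
  refine (HasNhdExtension.of_slabs hA hf (S := S ∩ (G₀ ∪ G₁)) hfS g.continuous (fun y => (hg y).1)
    (G := fun m => if m = 0 then G₀ else G₁) (fun m => by split_ifs <;> assumption)
    (fun m => ?_) fun m y hy h1 h2 => ?_)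
  · split_ifs
    · rwa [inter_assoc, inter_eq_self_of_subset_right (s := G₀ ∪ G₁) subset_union_left]
    · rwa [inter_assoc, inter_eq_self_of_subset_right (s := G₀ ∪ G₁) subset_union_right]
  · split_ifs with h
    · subst h
      exact ((hg y).2 hy).1 (by simpa using h2)
    · refine ((hg y).2 hy).2 (le_trans ?_ h1)
      exact_mod_cast Nat.one_le_iff_ne_zero.2 h

/-- An increasing countable union of relatively open absolute neighbourhood extensors is one. -/
theorem IsANE.iUnion_of_monotone {G : ℕ → Set E} (hG : ∀ m, IsOpen (G m)) (hmono : Monotone G)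
    (h : ∀ m, IsANE.{u} (S ∩ G m)) (hSG : S ⊆ ⋃ m, G m) : IsANE.{u} S := by
  intro Y _ _ A hA f hf hfS
  let := metrizableSpaceMetric Y
  obtain ⟨g, hg⟩ := exists_continuous_forall_mem_convex_of_local_const (X := Y) (E := ℝ)
    (t := fun y => {r | 0 ≤ r ∧ (y ∈ A → ∀ m : ℕ, r ≤ m + 1 → f y ∈ G m)})
    (fun y => by
      refine OrdConnected.convex ⟨fun a ha b hb r hr => ⟨ha.1.trans hr.1, fun hy m h =>
        ha.2 hy m (hr.1.trans h)⟩⟩)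
    (fun y => by
      by_cases hy : y ∈ A
      · obtain ⟨k, hk⟩ := mem_iUnion.1 (hSG (hfS hy))
        have := (hf y hy).eventually ((hG k).mem_nhds hk)
        rw [eventually_nhdsWithin_iff] at this
        refine ⟨k + 1, this.mono fun z hz => ⟨by positivity, fun hzA m hm => hmono ?_ (hz hzA)⟩⟩
        exact_mod_cast (by linarith : (k : ℝ) ≤ m)
      · refine ⟨0, Filter.Eventually.mono (hA.isOpen_compl.mem_nhds hy) ?_⟩
        exact fun z hz => ⟨le_rfl, fun h => (hz h).elim⟩)
  exact HasNhdExtension.of_slabs hA hf hfS g.continuous (fun y => (hg y).1) hG h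
    fun m y hy _ h2 => (hg y).2 hy m h2

/-- **Hanner's theorem**: in a second countable space, a set that is locally an absolute
neighbourhood extensor is an absolute neighbourhood extensor. -/
theorem IsANE.of_locally [SecondCountableTopology E]
    (h : ∀ z ∈ S, ∃ G, IsOpen G ∧ z ∈ G ∧ IsANE.{u} (S ∩ G)) : IsANE.{u} S := by
  choose! G hG hzG hGS using h
  obtain ⟨T, hT, hTU⟩ := isOpen_iUnion_countable (fun z : S => G z) fun z => hG z z.2
  rcases T.eq_empty_or_nonempty with rfl | hne
  · have : S = ∅ := by
      refine eq_empty_of_forall_notMem fun z hz => ?_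
      have : z ∈ ⋃ z : S, G z := mem_iUnion.2 ⟨⟨z, hz⟩, hzG z hz⟩
      rw [← hTU] at this
      simp at this
    rw [this]
    exact isANE_empty
  obtain ⟨e, he⟩ := hT.exists_eq_range hne
  refine IsANE.iUnion_of_monotone (G := accumulate fun m => G (e m)) (fun m => ?_)
    monotone_accumulate (fun m => ?_) ?_
  · exact isOpen_biUnion fun i _ => hG _ (e i).2
  · induction m with
    | zero => simpa [accumulate_zero_nat] using hGS _ (e 0).2
    | succ m ih =>
      rw [accumulate_succ]
      exact IsANE.union_of_isOpen (isOpen_biUnion fun i _ => hG _ (e i).2) (hG _ (e (m + 1)).2) ih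
        (hGS _ (e (m + 1)).2)
  · intro z hz
    rw [iUnion_accumulate]
    have : z ∈ ⋃ z : S, G z := mem_iUnion.2 ⟨⟨z, hz⟩, hzG z hz⟩
    rw [← hTU, he] at this
    simpa using this
end

section
open Set Filter
universe v

/-! ### Gluing along a deformation -/

/-- If `Z \ C` and `Z ∩ C` are absolute neighbourhood extensors, with `C` closed, and the relatively
open part `Z ∩ G` deforms within `Z` into `C`, keeping the points of `C` fixed, then `Z ∩ G` is an
absolute neighbourhood extensor. -/
theorem IsANE.of_deformation {E : Type v} [TopologicalSpace E] [MetrizableSpace E] {Z C G : Set E}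
    (hC : IsClosed C) (hG : IsOpen G) (hZC : IsANE.{u} (Z ∩ C)) (hZ_C : IsANE.{u} (Z \ C))
    {h : ℝ → E → E} (hc : ContinuousOn (fun p : ℝ × E => h p.1 p.2) (Icc 0 1 ×ˢ (Z ∩ G)))
    (h0 : ∀ z ∈ Z ∩ G, h 0 z = z) (h1 : ∀ z ∈ Z ∩ G, h 1 z ∈ C)
    (hZ : ∀ t ∈ Icc (0 : ℝ) 1, ∀ z ∈ Z ∩ G, h t z ∈ Z)
    (hfix : ∀ t ∈ Icc (0 : ℝ) 1, ∀ z ∈ Z ∩ G, z ∈ C → h t z = z) : IsANE.{u} (Z ∩ G) := by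
  classical
  intro Y _ _ A hA f hf hfS
  let := metrizableSpaceMetric Y
  let := metrizableSpaceMetric E
  set A₀ := A ∩ f ⁻¹' C with hA₀
  have hA₀c : IsClosed A₀ := hf.preimage_isClosed_of_isClosed hA hC
  obtain ⟨U, hU, hAU, hUA, F, hF, hFZ, hFf⟩ := hZ_C.exists_extension_in_open hA₀c.isOpen_compl hA
    (f := f) (hf.mono inter_subset_left) fun y hy => ⟨(hfS hy.1).1, fun h => hy.2 ⟨hy.1, h⟩⟩
  rcases A₀.eq_empty_or_nonempty with hemp | hne
  · refine HasNhdExtension.inter ⟨U, hU, ?_, F, hF, fun y hy => (hFZ hy).1, ?_⟩ hG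
      fun y hy => (hfS hy).2
    · simpa [hemp] using hAU
    · simpa [hemp] using hFf
  -- Shrink `U` so that `F`, together with `f` on `A₀`, is continuous along `A₀`.
  set U₁ := {y | y ∈ U ∧ F y ∈ G ∧ ∃ a ∈ A ∩ A₀ᶜ, dist y a < Metric.infDist y A₀ ∧
    dist (F y) (f a) < Metric.infDist y A₀} with hU₁
  have hU₁o : IsOpen U₁ := by
    refine isOpen_iff_mem_nhds.2 ?_
    rintro y ⟨hy, hyG, a, ha, h2, h3⟩
    have hFy := hF.continuousAt (hU.mem_nhds hy)
    filter_upwards [hU.mem_nhds hy, hFy (hG.mem_nhds hyG),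
      (continuous_id.dist continuous_const).continuousAt.eventually_lt
        (Metric.continuous_infDist_pt A₀).continuousAt h2,
      (hFy.dist continuousAt_const).eventually_lt
        (Metric.continuous_infDist_pt A₀).continuousAt h3] with z hz1 hz2 hz3 hz4
    exact ⟨hz1, hz2, a, ha, hz3, hz4⟩
  have hAU₁ : A ∩ A₀ᶜ ⊆ U₁ := by
    intro y hy
    have hpos : 0 < Metric.infDist y A₀ := (hA₀c.notMem_iff_infDist_pos hne).1 hy.2
    refine ⟨hAU hy, ?_, y, hy, by simpa using hpos, ?_⟩
    · rw [hFf hy]; exact (hfS hy.1).2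
    · rw [hFf hy]; simpa using hpos
  have hU₁A₀ : ∀ y ∈ U₁, y ∉ A₀ := fun y hy => hUA hy.1
  set F' : Y → E := fun y => if y ∈ A₀ then f y else F y with hF'
  have hF'0 : ∀ y ∈ A₀, F' y = f y := fun y hy => if_pos hy
  have hF'1 : ∀ y ∈ U₁, F' y = F y := fun y hy => if_neg (hU₁A₀ y hy)
  have hF'A : ∀ y ∈ A, F' y = f y := by
    intro y hy
    by_cases hy0 : y ∈ A₀
    · exact hF'0 y hy0
    · rw [hF'1 y (hAU₁ ⟨hy, hy0⟩), hFf ⟨hy, hy0⟩]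
  have hF'S : ∀ y ∈ A₀ ∪ U₁, F' y ∈ Z ∩ G := by
    rintro y (hy | hy)
    · rw [hF'0 y hy]; exact hfS hy.1
    · rw [hF'1 y hy]; exact ⟨(hFZ hy.1).1, hy.2.1⟩
  have hF'c : ContinuousOn F' (A₀ ∪ U₁) := by
    rintro y (hy | hy)
    · rw [Metric.continuousWithinAt_iff]
      intro ε hε
      obtain ⟨δ, hδ, hfδ⟩ := Metric.continuousWithinAt_iff.1 (hf y hy.1) (ε / 2) (half_pos hε)
      refine ⟨min (δ / 2) (ε / 2), by positivity, ?_⟩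
      intro z hz hzy
      rw [hF'0 y hy]
      rcases hz with hz | hz
      · rw [hF'0 z hz]
        exact (hfδ hz.1 (hzy.trans_le ((min_le_left _ _).trans (half_le_self hδ.le)))).trans
          (half_lt_self hε)
      · rw [hF'1 z hz]
        obtain ⟨-, -, a, ha, h2, h3⟩ := hz
        have hzd : Metric.infDist z A₀ ≤ dist z y := Metric.infDist_le_dist_of_mem hy
        have hay : dist a y < δ := by
          have := dist_triangle_left a y z
          have := hzy.trans_le (min_le_left _ _)
          linarith
        have := hfδ ha.1 hay
        have := dist_triangle (F z) (f a) (f y)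
        have := hzy.trans_le (min_le_right _ _)
        linarith
    · refine ContinuousAt.continuousWithinAt ?_
      refine (hF.continuousAt (hU.mem_nhds hy.1)).congr ?_
      filter_upwards [hU₁o.mem_nhds hy] with z hz using (hF'1 z hz).symm
  have hne₁ : U₁ᶜ.Nonempty := hne.mono fun y hy h => hU₁A₀ y h hy
  set dA := fun y => Metric.infDist y A with hdA
  set dU := fun y => Metric.infDist y U₁ᶜ with hdU
  have hdAc : Continuous dA := Metric.continuous_infDist_pt A
  have hdUc : Continuous dU := Metric.continuous_infDist_pt _
  have hdU0 : ∀ y, 0 < dU y ↔ y ∈ U₁ := fun y => by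
    rw [hdU, ← hU₁o.isClosed_compl.notMem_iff_infDist_pos hne₁, notMem_compl_iff]
  have hdA0 : ∀ y, dA y = 0 ↔ y ∈ A := fun y =>
    (hA.mem_iff_infDist_zero (hne.mono inter_subset_left)).symm
  have hdAn : ∀ y, 0 ≤ dA y := fun y => Metric.infDist_nonneg
  have hdUn : ∀ y, 0 ≤ dU y := fun y => Metric.infDist_nonneg
  -- `D` is a closed neighbourhood of `A \ A₀` relative to the complement of `A₀`.
  set D := {y | dA y ≤ dU y} with hD
  have hDc : IsClosed D := isClosed_le hdAc hdUc
  have hDU : D ⊆ A₀ ∪ U₁ := by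
    intro y (hy : dA y ≤ dU y)
    by_cases hyU : y ∈ U₁
    · exact Or.inr hyU
    · have : dU y ≤ 0 := not_lt.1 fun h => hyU ((hdU0 y).1 h)
      have hyA := (hdA0 y).1 (le_antisymm (hy.trans this) (hdAn y))
      exact Or.inl (by_contra fun h => hyU (hAU₁ ⟨hyA, h⟩))
  have hAD : A ⊆ D := fun y hy => by
    change dA y ≤ dU y
    rw [(hdA0 y).2 hy]; exact hdUn y
  have hgc : ContinuousOn (fun y => h 1 (F' y)) D :=
    hc.comp (continuousOn_const.prodMk (hF'c.mono hDU))
      fun y hy => ⟨right_mem_Icc.2 zero_le_one, hF'S y (hDU hy)⟩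
  obtain ⟨U₂, hU₂, hDU₂, g, hg, hgS, hgf⟩ := hZC Y D hDc _ hgc fun y hy =>
    ⟨hZ 1 (right_mem_Icc.2 zero_le_one) _ (hF'S y (hDU hy)), h1 _ (hF'S y (hDU hy))⟩
  set s : Y → ℝ := fun y => min 1 (dA y / dU y) with hs
  have hs01 : ∀ y, s y ∈ Icc (0 : ℝ) 1 := fun y =>
    ⟨le_min zero_le_one (div_nonneg (hdAn y) (hdUn y)), min_le_left _ _⟩
  set H : Y → E := fun y => if y ∈ D then h (s y) (F' y) else g y with hH
  have hHc : ContinuousOn (fun y => h (s y) (F' y)) D := by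
    intro y hy
    rcases hDU hy with hy0 | hy1
    · -- `s` may be discontinuous at `y`, but `F' y` is fixed by the whole homotopy.
      have hyS := hF'S y (Or.inl hy0)
      have hyC : F' y ∈ C := by rw [hF'0 y hy0]; exact hy0.2
      change Tendsto _ _ (𝓝 (h (s y) (F' y)))
      rw [hfix _ (hs01 y) _ hyS hyC]
      intro V hV
      have key : ∀ᶠ z in 𝓝 (F' y), ∀ t ∈ Icc (0 : ℝ) 1, t ∈ Icc (0 : ℝ) 1 → z ∈ Z ∩ G →
          h t z ∈ V := by
        refine isCompact_Icc.eventually_forall_of_forall_eventually fun t ht => ?_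
        have h2 := hc (t, F' y) ⟨ht, hyS⟩
        change Tendsto _ _ (𝓝 (h t (F' y))) at h2
        rw [hfix _ ht _ hyS hyC] at h2
        have h3 := h2 hV
        rw [mem_map, mem_nhdsWithin_iff_eventually] at h3
        have h4 : Tendsto (fun p : E × ℝ => (p.2, p.1)) (𝓝 (F' y, t)) (𝓝 (t, F' y)) :=
          continuous_swap.tendsto _
        exact (h4.eventually h3).mono fun p hp h6 h7 => hp ⟨h6, h7⟩
      have h2 := (hF'c y (Or.inl hy0)).mono hDU
      rw [mem_map]
      filter_upwards [h2 key, self_mem_nhdsWithin] with z hz hzD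
      exact hz _ (hs01 z) (hs01 z) (hF'S z (hDU hzD))
    · have h2 : ContinuousAt s y :=
        continuousAt_const.min (hdAc.continuousAt.div hdUc.continuousAt ((hdU0 y).2 hy1).ne')
      exact ContinuousWithinAt.comp (f := fun y => (s y, F' y)) (t := Icc 0 1 ×ˢ (Z ∩ G))
        (hc (s y, F' y) ⟨hs01 y, hF'S y (Or.inr hy1)⟩)
        (h2.continuousWithinAt.prodMk ((hF'c y (Or.inr hy1)).mono hDU))
        fun z hz => ⟨hs01 z, hF'S z (hDU hz)⟩
  have hbd : ∀ y ∈ D, dU y ≤ dA y → h (s y) (F' y) = g y := by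
    intro y hy hy'
    rw [hgf hy]
    rcases hDU hy with hy0 | hy1
    · have hyS := hF'S y (Or.inl hy0)
      have hyC : F' y ∈ C := by rw [hF'0 y hy0]; exact hy0.2
      change _ = h 1 (F' y)
      rw [hfix _ (hs01 y) _ hyS hyC, hfix _ (right_mem_Icc.2 zero_le_one) _ hyS hyC]
    · have h2 := (hdU0 y).2 hy1
      have : s y = 1 := min_eq_left ((one_le_div h2).2 hy')
      rw [this]
  have hHU₂ : ContinuousOn H U₂ := by
    have e1 : ContinuousOn H (U₂ ∩ D) := (hHc.mono inter_subset_right).congr fun y hy => if_pos hy.2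
    have e2 : ContinuousOn H (U₂ ∩ {y | dU y ≤ dA y}) := by
      refine (hg.mono inter_subset_left).congr fun y hy => ?_
      by_cases hyD : y ∈ D
      · simp only [hH, if_pos hyD]; exact hbd y hyD hy.2
      · simp only [hH, if_neg hyD]
    have : U₂ ⊆ D ∪ {y | dU y ≤ dA y} := fun y _ => le_total (dA y) (dU y)
    rw [← inter_eq_self_of_subset_left this]
    intro y hy
    rw [inter_union_distrib_left]
    refine ContinuousWithinAt.union ?_ ?_
    · by_cases hyD : y ∈ D
      · exact e1 y ⟨hy.1, hyD⟩
      · exact continuousWithinAt_of_notMem_closure fun hcl =>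
          hyD (hDc.closure_subset_iff.2 inter_subset_right hcl)
    · by_cases hyD : dU y ≤ dA y
      · exact e2 y ⟨hy.1, hyD⟩
      · exact continuousWithinAt_of_notMem_closure fun hcl =>
          hyD ((isClosed_le hdUc hdAc).closure_subset_iff.2 inter_subset_right hcl)
  refine HasNhdExtension.inter ⟨U₂, hU₂, hAD.trans hDU₂, H, hHU₂, fun y hy => ?_, fun y hy => ?_⟩ hG
    fun y hy => (hfS hy).2
  · by_cases hyD : y ∈ D
    · simp only [hH, if_pos hyD]
      exact hZ _ (hs01 y) _ (hF'S y (hDU hyD))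
    · simp only [hH, if_neg hyD]
      exact (hgS hy).1
  · have : s y = 0 := by simp [hs, (hdA0 y).2 hy]
    simp only [hH, if_pos (hAD hy), this]
    rw [h0 _ (hF'S y (hDU (hAD hy))), hF'A y hy]
end

section
open Set Filter
universe v w

set_option linter.unusedSectionVars false

/-! ### Finitely supported measures and their heavy points -/

variable {X : Type v} [TopologicalSpace X] [MetrizableSpace X] [CompactSpace X] [MeasurableSpace X]
  [BorelSpace X]

open Classical in
/-- The finite set of atoms of a finitely supported measure; the junk value for a measure of
infinite support is `∅`. -/
noncomputable def atoms (μ : ProbabilityMeasure X) : Finset X :=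
  if h : (μ : Measure X).support.Finite then h.toFinset else ∅

theorem coe_atoms {μ : ProbabilityMeasure X} (h : (μ : Measure X).support.Finite) :
    (atoms μ : Set X) = (μ : Measure X).support := by
  rw [atoms, dif_pos h, h.coe_toFinset]

theorem card_atoms {μ : ProbabilityMeasure X} (h : (μ : Measure X).support.Finite) :
    (atoms μ).card = (μ : Measure X).support.ncard := by
  rw [← coe_atoms h, ncard_coe_finset]

theorem measure_compl_atoms {μ : ProbabilityMeasure X} (h : (μ : Measure X).support.Finite) :
    (μ : Measure X) (atoms μ : Set X)ᶜ = 0 := by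
  rw [coe_atoms h]
  exact Measure.measure_compl_support

theorem mem_atoms {μ : ProbabilityMeasure X} (h : (μ : Measure X).support.Finite) {z : X} :
    z ∈ atoms μ ↔ 0 < (μ : Measure X).real {z} := by
  rw [← Finset.mem_coe, coe_atoms h, measureReal_def, ENNReal.toReal_pos_iff,
    Measure.mem_support_iff_forall]
  constructor
  · intro hz
    -- the complement of the other support points is an open neighbourhood of `z`
    have hU : ((μ : Measure X).support \ {z})ᶜ ∈ 𝓝 z :=
      (h.subset sdiff_subset).isClosed.isOpen_compl.mem_nhds (by simp)
    refine ⟨(hz _ hU).trans_le ?_, measure_lt_top _ _⟩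
    have hsub : ((μ : Measure X).support \ {z})ᶜ ⊆ {z} ∪ (μ : Measure X).supportᶜ := by
      intro y hy
      by_cases hyz : y = z
      · exact Or.inl hyz
      · exact Or.inr fun hys => hy ⟨hys, hyz⟩
    refine (measure_mono hsub).trans ((measure_union_le _ _).trans ?_)
    rw [Measure.measure_compl_support, add_zero]
  · intro hz U hU
    exact hz.1.trans_le (measure_mono (singleton_subset_iff.2 (mem_of_mem_nhds hU)))

theorem support_subset_of_measure_compl {μ : ProbabilityMeasure X} {F : Finset X}
    (h : (μ : Measure X) (F : Set X)ᶜ = 0) : (μ : Measure X).support ⊆ F :=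
  Measure.support_subset_of_isClosed F.finite_toSet.isClosed (mem_ae_iff.2 h)

theorem finite_support_of_measure_compl {μ : ProbabilityMeasure X} {F : Finset X}
    (h : (μ : Measure X) (F : Set X)ᶜ = 0) : (μ : Measure X).support.Finite :=
  F.finite_toSet.subset (support_subset_of_measure_compl h)

theorem atoms_subset {μ : ProbabilityMeasure X} {F : Finset X}
    (h : (μ : Measure X) (F : Set X)ᶜ = 0) : atoms μ ⊆ F := by
  rw [← Finset.coe_subset, coe_atoms (finite_support_of_measure_compl h)]
  exact support_subset_of_measure_compl h

theorem integral_eq_sum {μ : ProbabilityMeasure X} {F : Finset X}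
    (h : (μ : Measure X) (F : Set X)ᶜ = 0) (g : X → ℝ) :
    ∫ z, g z ∂(μ : Measure X) = ∑ z ∈ F, (μ : Measure X).real {z} * g z := by
  have h1 := setIntegral_finset (μ := (μ : Measure X)) (f := g) F IntegrableOn.finset
  rw [Measure.restrict_eq_self_of_ae_mem (s := (F : Set X)) (mem_ae_iff.2 h)] at h1
  simpa only [smul_eq_mul] using h1

theorem sum_real_eq_one {μ : ProbabilityMeasure X} {F : Finset X}
    (h : (μ : Measure X) (F : Set X)ᶜ = 0) : ∑ z ∈ F, (μ : Measure X).real {z} = 1 := by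
  have := integral_eq_sum h fun _ => 1
  simpa using this.symm

theorem finite_support {μ : ProbabilityMeasure X} (h : μ ∈ Pf X) :
    (μ : Measure X).support.Finite := h.1

theorem card_atoms_pos {μ : ProbabilityMeasure X} (h : μ ∈ Pf X) : 0 < (atoms μ).card := by
  obtain ⟨hf, x, hx, -⟩ := h
  rw [Finset.card_pos]
  exact ⟨x, by rwa [← Finset.mem_coe, coe_atoms hf]⟩

theorem exists_heavy {μ : ProbabilityMeasure X} (h : μ ∈ Pf X) :
    ∃ x, 2 / 3 ≤ (μ : Measure X).real {x} ∧
      1 - 1 / ((atoms μ).card + 1 : ℝ) ≤ (μ : Measure X).real {x} := by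
  have hpos := card_atoms_pos h
  have hf := finite_support h
  obtain ⟨-, x, hx, hm⟩ := h
  rw [← card_atoms hf] at hm
  refine ⟨x, ?_, hm⟩
  rcases (Nat.succ_le_of_lt hpos).eq_or_lt with h1 | h1
  · have hx' : x ∈ atoms μ := by rwa [← Finset.mem_coe, coe_atoms hf]
    obtain ⟨y, hy⟩ := Finset.card_eq_one.1 h1.symm
    have h2 := sum_real_eq_one (measure_compl_atoms hf)
    rw [hy] at h2 hx'
    rw [Finset.mem_singleton.1 hx']
    rw [Finset.sum_singleton] at h2
    rw [h2]; norm_num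
  · refine le_trans ?_ hm
    have h3 : (3 : ℝ) ≤ (atoms μ).card + 1 := by
      have : (2 : ℝ) ≤ (atoms μ).card := by exact_mod_cast (show 2 ≤ (atoms μ).card by omega)
      linarith
    have := one_div_le_one_div_of_le (by norm_num) h3
    linarith

/-- The point carrying at least two thirds of the mass, if there is one. It exists for the measures
in `Pf X`. -/
noncomputable def heavy (μ : ProbabilityMeasure X) : X :=
  @Classical.epsilon X μ.nonempty fun x => 2 / 3 ≤ (μ : Measure X).real {x}

theorem real_singleton_add_le_one {μ : ProbabilityMeasure X} {x y : X} (h : x ≠ y) :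
    (μ : Measure X).real {x} + (μ : Measure X).real {y} ≤ 1 := by
  rw [← measureReal_union (by simpa using h) (measurableSet_singleton y)]
  exact measureReal_le_one

theorem heavy_eq {μ : ProbabilityMeasure X} {x : X} (h : 2 / 3 ≤ (μ : Measure X).real {x}) :
    heavy μ = x := by
  by_contra hne
  have h1 : 2 / 3 ≤ (μ : Measure X).real {heavy μ} :=
    Classical.epsilon_spec (p := fun x => 2 / 3 ≤ (μ : Measure X).real {x}) ⟨x, h⟩
  have := real_singleton_add_le_one (μ := μ) hne
  linarith

theorem le_real_heavy {μ : ProbabilityMeasure X} (h : μ ∈ Pf X) :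
    2 / 3 ≤ (μ : Measure X).real {heavy μ} := by
  obtain ⟨x, hx, -⟩ := exists_heavy h
  rwa [heavy_eq hx]

theorem one_sub_le_real_heavy {μ : ProbabilityMeasure X} (h : μ ∈ Pf X) :
    1 - 1 / ((atoms μ).card + 1 : ℝ) ≤ (μ : Measure X).real {heavy μ} := by
  obtain ⟨x, hx, hx'⟩ := exists_heavy h
  rwa [heavy_eq hx]

theorem heavy_mem_atoms {μ : ProbabilityMeasure X} (h : μ ∈ Pf X) : heavy μ ∈ atoms μ :=
  (mem_atoms (finite_support h)).2 (lt_of_lt_of_le (by norm_num) (le_real_heavy h))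

theorem mem_Pf_of_finset {μ : ProbabilityMeasure X} {F : Finset X} {x : X} {n : ℕ} (hn : 0 < n)
    (hF : (μ : Measure X) (F : Set X)ᶜ = 0) (hFn : F.card ≤ n)
    (hm : 1 - 1 / (n + 1 : ℝ) ≤ (μ : Measure X).real {x}) :
    μ ∈ Pf X ∧ (atoms μ).card ≤ n := by
  have hfin := finite_support_of_measure_compl hF
  have hc : (atoms μ).card ≤ n := (Finset.card_le_card (atoms_subset hF)).trans hFn
  have hpos : 0 < (μ : Measure X).real {x} := by
    refine lt_of_lt_of_le ?_ hm
    have : (2 : ℝ) ≤ n + 1 := by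
      have : (1 : ℝ) ≤ n := by exact_mod_cast hn
      linarith
    have := one_div_le_one_div_of_le (by norm_num) this
    linarith
  refine ⟨⟨hfin, x, ?_, ?_⟩, hc⟩
  · rw [← coe_atoms hfin]
    exact (mem_atoms hfin).2 hpos
  · rw [← card_atoms hfin]
    refine le_trans ?_ hm
    have : ((atoms μ).card : ℝ) + 1 ≤ n + 1 := by
      have : ((atoms μ).card : ℝ) ≤ n := by exact_mod_cast hc
      linarith
    have := one_div_le_one_div_of_le (by positivity) this
    linarith

/-- Positivity of an integral against a finitely supported measure is witnessed by an atom. -/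
theorem integral_pos_iff_exists_atom {μ : ProbabilityMeasure X}
    (hf : (μ : Measure X).support.Finite) {g : X → ℝ} (hg : ∀ z, 0 ≤ g z) :
    0 < ∫ z, g z ∂(μ : Measure X) ↔ ∃ z ∈ atoms μ, 0 < g z := by
  rw [integral_eq_sum (measure_compl_atoms hf)]
  rw [Finset.sum_pos_iff_of_nonneg fun z _ => mul_nonneg measureReal_nonneg (hg z)]
  refine exists_congr fun z => and_congr_right fun hz => ?_
  exact mul_pos_iff_of_pos_left ((mem_atoms hf).1 hz)

theorem eq_of_forall_integral_eq {μ ν : ProbabilityMeasure X}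
    (h : ∀ g : X → ℝ, Continuous g → ∫ z, g z ∂(μ : Measure X) = ∫ z, g z ∂(ν : Measure X)) :
    μ = ν :=
  ProbabilityMeasure.toMeasure_injective
    (ext_of_forall_integral_eq_of_IsFiniteMeasure fun g => h g g.continuous)

theorem continuous_integral {g : X → ℝ} (hg : Continuous g) :
    Continuous fun μ : ProbabilityMeasure X => ∫ z, g z ∂(μ : Measure X) :=
  ProbabilityMeasure.continuous_integral_continuousMap (⟨g, hg⟩ : C(X, ℝ))

/-- Integrals depend continuously on the measure and the integrand together. -/
theorem continuous_integral_of_jointly {Θ : Type w} [TopologicalSpace Θ]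
    {μ : Θ → ProbabilityMeasure X} (hμ : Continuous μ) {g : Θ → X → ℝ}
    (hg : Continuous fun p : Θ × X => g p.1 p.2) :
    Continuous fun θ => ∫ z, g θ z ∂(μ θ : Measure X) := by
  have hgθ : ∀ θ, Continuous (g θ) := fun θ => hg.comp (by fun_prop : Continuous fun z => (θ, z))
  have hint : ∀ (f : X → ℝ) (hf : Continuous f) (ν : ProbabilityMeasure X),
      Integrable f (ν : Measure X) := fun f hf ν =>
    (BoundedContinuousFunction.mkOfCompact ⟨f, hf⟩).integrable _
  let G : C(Θ, C(X, ℝ)) := ContinuousMap.curry ⟨fun p : Θ × X => g p.1 p.2, hg⟩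
  refine continuous_iff_continuousAt.2 fun θ₀ => ?_
  have h1 : Tendsto (fun θ => ∫ z, g θ₀ z ∂(μ θ : Measure X)) (𝓝 θ₀)
      (𝓝 (∫ z, g θ₀ z ∂(μ θ₀ : Measure X))) :=
    ((continuous_integral (hgθ θ₀)).comp hμ).tendsto θ₀
  have h2 : Tendsto (fun θ => ‖G θ - G θ₀‖) (𝓝 θ₀) (𝓝 0) := by
    have := (G.continuous.sub (continuous_const (y := G θ₀))).norm.tendsto θ₀
    simpa using this
  have h3 : Tendsto (fun θ => ∫ z, (g θ z - g θ₀ z) ∂(μ θ : Measure X)) (𝓝 θ₀) (𝓝 0) := by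
    refine squeeze_zero_norm (fun θ => ?_) h2
    refine (norm_integral_le_of_norm_le_const (C := ‖G θ - G θ₀‖)
      (Eventually.of_forall fun z => ?_)).trans (by simp)
    exact (G θ - G θ₀).norm_coe_le_norm z
  have h4 := h3.add h1
  rw [zero_add] at h4
  refine h4.congr fun θ => ?_
  rw [integral_sub (hint _ (hgθ θ) _) (hint _ (hgθ θ₀) _)]
  ring

theorem continuousOn_heavy : ContinuousOn heavy (Pf X) := by
  classical
  intro μ hμ
  refine tendsto_nhds.2 fun G hG hμG => ?_
  obtain ⟨g, hg0, hg1, hg01⟩ := exists_continuous_zero_one_of_isClosed hG.isClosed_compl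
    (isClosed_singleton (x := heavy μ)) (by simpa using hμG)
  have hlow : 2 / 3 ≤ ∫ z, g z ∂(μ : Measure X) := by
    rw [integral_eq_sum (measure_compl_atoms (finite_support hμ))]
    refine le_trans ?_ (Finset.single_le_sum (f := fun z => (μ : Measure X).real {z} * g z)
      (fun z _ => mul_nonneg measureReal_nonneg (hg01 z).1) (heavy_mem_atoms hμ))
    have : g (heavy μ) = 1 := hg1 rfl
    simp only [this, mul_one]
    exact le_real_heavy hμ
  have hev : ∀ᶠ ν : ProbabilityMeasure X in 𝓝 μ, 1 / 2 < ∫ z, g z ∂(ν : Measure X) :=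
    (continuous_integral g.continuous).continuousAt.eventually
      (lt_mem_nhds (by linarith))
  filter_upwards [nhdsWithin_le_nhds hev, self_mem_nhdsWithin] with ν hν hνP
  by_contra hνG
  have hc := measure_compl_atoms (finite_support hνP)
  have h1 := sum_real_eq_one hc
  rw [integral_eq_sum hc] at hν
  rw [← Finset.add_sum_erase _ _ (heavy_mem_atoms hνP)] at h1 hν
  have h0 : g (heavy ν) = 0 := hg0 hνG
  have h2 : ∑ z ∈ (atoms ν).erase (heavy ν), (ν : Measure X).real {z} * g z ≤
      ∑ z ∈ (atoms ν).erase (heavy ν), (ν : Measure X).real {z} :=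
    Finset.sum_le_sum fun z _ => mul_le_of_le_one_right measureReal_nonneg (hg01 z).2
  have h3 := le_real_heavy hνP
  rw [h0, mul_zero, zero_add] at hν
  linarith

/-! ### Building measures from a heavy point and light atoms -/

/-- The measure with mass `m i` at `c i` for `i ∈ s` and the rest of the mass at `x`. The junk value
for data that do not give a probability measure is the Dirac measure at `x`. -/
noncomputable def starMeasure {ι : Type w} (s : Finset ι) (m : ι → ℝ) (c : ι → X) (x : X) :
    ProbabilityMeasure X :=
  open Classical in
  if h : IsProbabilityMeasure (∑ i ∈ s, ENNReal.ofReal (m i) • Measure.dirac (c i) +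
      ENNReal.ofReal (1 - ∑ i ∈ s, m i) • Measure.dirac x) then (⟨_, h⟩ : ProbabilityMeasure X)
  else ⟨Measure.dirac x, Measure.dirac.isProbabilityMeasure⟩

section
variable {ι : Type w} {s : Finset ι} {m : ι → ℝ} {c : ι → X} {x : X}

theorem toMeasure_starMeasure (hm : ∀ i ∈ s, 0 ≤ m i) (hs : ∑ i ∈ s, m i ≤ 1) :
    (starMeasure s m c x : Measure X) = ∑ i ∈ s, ENNReal.ofReal (m i) • Measure.dirac (c i) +
      ENNReal.ofReal (1 - ∑ i ∈ s, m i) • Measure.dirac x := by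
  have : IsProbabilityMeasure (∑ i ∈ s, ENNReal.ofReal (m i) • Measure.dirac (c i) +
      ENNReal.ofReal (1 - ∑ i ∈ s, m i) • Measure.dirac x) := by
    constructor
    simp only [Measure.coe_add, Measure.coe_finsetSum, Measure.coe_smul, Pi.add_apply,
      Finset.sum_apply, Pi.smul_apply, measure_univ, smul_eq_mul, mul_one]
    rw [← ENNReal.ofReal_sum_of_nonneg hm,
      ← ENNReal.ofReal_add (Finset.sum_nonneg hm) (sub_nonneg.2 hs)]
    simp
  have h : starMeasure s m c x = (⟨_, this⟩ : ProbabilityMeasure X) := dif_pos this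
  rw [h]
  rfl

theorem integral_starMeasure (hm : ∀ i ∈ s, 0 ≤ m i) (hs : ∑ i ∈ s, m i ≤ 1) (g : X → ℝ) :
    ∫ z, g z ∂(starMeasure s m c x : Measure X) =
      ∑ i ∈ s, m i * g (c i) + (1 - ∑ i ∈ s, m i) * g x := by
  have hi : ∀ (r : ℝ) (y : X), Integrable g (ENNReal.ofReal r • Measure.dirac y) := fun r y =>
    (integrable_dirac enorm_lt_top).smul_measure ENNReal.ofReal_ne_top
  rw [toMeasure_starMeasure hm hs, integral_add_measure
    (integrable_finsetSum_measure.2 fun i _ => hi _ _) (hi _ _),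
    integral_finsetSum_measure fun i _ => hi _ _]
  simp only [integral_smul_measure, integral_dirac, smul_eq_mul,
    ENNReal.toReal_ofReal (sub_nonneg.2 hs)]
  congr 1
  exact Finset.sum_congr rfl fun i hi => by rw [ENNReal.toReal_ofReal (hm i hi)]

theorem starMeasure_compl [DecidableEq X] (hm : ∀ i ∈ s, 0 ≤ m i) (hs : ∑ i ∈ s, m i ≤ 1) :
    (starMeasure s m c x : Measure X) (insert x (s.image c) : Finset X)ᶜ = 0 := by
  rw [toMeasure_starMeasure hm hs]
  simp only [Measure.coe_add, Measure.coe_finsetSum, Measure.coe_smul, Pi.add_apply,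
    Finset.sum_apply, Pi.smul_apply, smul_eq_mul, add_eq_zero, Finset.sum_eq_zero_iff]
  have hms : MeasurableSet ((insert x (s.image c) : Finset X) : Set X)ᶜ :=
    (Finset.measurableSet _).compl
  constructor
  · intro i hi
    rw [Measure.dirac_apply' _ hms, indicator_of_notMem, mul_zero]
    rw [notMem_compl_iff]
    exact Finset.mem_coe.2 (Finset.mem_insert_of_mem (Finset.mem_image_of_mem c hi))
  · rw [Measure.dirac_apply' _ hms, indicator_of_notMem, mul_zero]
    rw [notMem_compl_iff]
    exact Finset.mem_coe.2 (Finset.mem_insert_self _ _)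

theorem real_starMeasure [DecidableEq X] (hm : ∀ i ∈ s, 0 ≤ m i) (hs : ∑ i ∈ s, m i ≤ 1) (z : X) :
    (starMeasure s m c x : Measure X).real {z} =
      (∑ i ∈ s, if c i = z then m i else 0) + if x = z then 1 - ∑ i ∈ s, m i else 0 := by
  have h := integral_starMeasure (c := c) (x := x) hm hs (({z} : Set X).indicator 1)
  rw [integral_indicator_one (measurableSet_singleton z)] at h
  rw [h]
  simp [indicator_apply]

end

end

section
open Set Filter
universe v w

set_option linter.unusedSectionVars false

variable {X : Type v} [TopologicalSpace X] [MetrizableSpace X] [CompactSpace X] [MeasurableSpace X]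
  [BorelSpace X]

section
variable {ι : Type w} {s : Finset ι} {m : ι → ℝ} {c : ι → X} {x : X}

theorem sub_le_real_starMeasure (hm : ∀ i ∈ s, 0 ≤ m i) (hs : ∑ i ∈ s, m i ≤ 1) :
    1 - ∑ i ∈ s, m i ≤ (starMeasure s m c x : Measure X).real {x} := by
  classical
  rw [real_starMeasure hm hs, if_pos rfl]
  have : 0 ≤ ∑ i ∈ s, if c i = x then m i else 0 :=
    Finset.sum_nonneg fun i hi => by split_ifs <;> [exact hm i hi; exact le_rfl]
  linarith

theorem le_real_starMeasure (hm : ∀ i ∈ s, 0 ≤ m i) (hs : ∑ i ∈ s, m i ≤ 1) {i : ι} (hi : i ∈ s) :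
    m i ≤ (starMeasure s m c x : Measure X).real {c i} := by
  classical
  rw [real_starMeasure hm hs]
  have h1 : m i ≤ ∑ j ∈ s, if c j = c i then m j else 0 := by
    have := Finset.single_le_sum (f := fun j => if c j = c i then m j else 0)
      (fun j hj => by split_ifs <;> [exact hm j hj; exact le_rfl]) hi
    simpa using this
  have h2 : 0 ≤ if x = c i then 1 - ∑ i ∈ s, m i else 0 := by
    split_ifs <;> [exact sub_nonneg.2 hs; exact le_rfl]
  linarith

theorem finite_support_starMeasure (hm : ∀ i ∈ s, 0 ≤ m i) (hs : ∑ i ∈ s, m i ≤ 1) :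
    (starMeasure s m c x : Measure X).support.Finite := by
  classical
  exact finite_support_of_measure_compl (starMeasure_compl hm hs)

theorem starMeasure_mem {n : ℕ} (hm : ∀ i ∈ s, 0 ≤ m i) (hn : s.card ≤ n)
    (hs : ∑ i ∈ s, m i ≤ 1 / (n + 2)) :
    starMeasure s m c x ∈ Pf X ∧ (atoms (starMeasure s m c x)).card ≤ n + 1 := by
  classical
  have h1 : (1 : ℝ) / (n + 2) ≤ 1 / 2 :=
    one_div_le_one_div_of_le two_pos (by linarith [(n.cast_nonneg : (0 : ℝ) ≤ n)])
  have hs1 : ∑ i ∈ s, m i ≤ 1 := by linarith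
  have hx := sub_le_real_starMeasure (c := c) (x := x) hm hs1
  exact mem_Pf_of_finset (n := n + 1) (x := x) n.succ_pos
    (starMeasure_compl (c := c) (x := x) hm hs1)
    ((Finset.card_insert_le _ _).trans (Nat.add_le_add_right (Finset.card_image_le.trans hn) 1))
    (by push_cast; rw [add_assoc, one_add_one_eq_two]; linarith)

theorem eq_starMeasure [DecidableEq X] {μ : ProbabilityMeasure X} (hμ : μ ∈ Pf X)
    (hc : InjOn c s) (himg : s.image c = (atoms μ).erase (heavy μ)) :
    starMeasure s (fun i => (μ : Measure X).real {c i}) c (heavy μ) = μ := by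
  have hcompl := measure_compl_atoms (finite_support hμ)
  have hsum : ∀ g : X → ℝ, ∑ i ∈ s, (μ : Measure X).real {c i} * g (c i) =
      ∑ z ∈ (atoms μ).erase (heavy μ), (μ : Measure X).real {z} * g z := fun g => by
    rw [← himg, Finset.sum_image hc]
  have h1 := sum_real_eq_one hcompl
  rw [← Finset.add_sum_erase _ _ (heavy_mem_atoms hμ)] at h1
  have h2 : ∑ i ∈ s, (μ : Measure X).real {c i} =
      ∑ z ∈ (atoms μ).erase (heavy μ), (μ : Measure X).real {z} := by
    simpa only [mul_one] using hsum fun _ => 1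
  have h3 := le_real_heavy hμ
  refine eq_of_forall_integral_eq fun g _ => ?_
  rw [integral_starMeasure (fun _ _ => measureReal_nonneg) (by rw [h2]; linarith), hsum, h2,
    integral_eq_sum hcompl, ← Finset.add_sum_erase _ _ (heavy_mem_atoms hμ), ← h1]
  ring

theorem continuous_starMeasure {Θ : Type*} [TopologicalSpace Θ] {m : Θ → ι → ℝ} {c : Θ → ι → X}
    {x : Θ → X} (hm : ∀ θ, ∀ i ∈ s, 0 ≤ m θ i) (hs : ∀ θ, ∑ i ∈ s, m θ i ≤ 1)
    (hmc : ∀ i ∈ s, Continuous fun θ => m θ i) (hcc : ∀ i ∈ s, Continuous fun θ => c θ i)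
    (hx : Continuous x) : Continuous fun θ => starMeasure s (m θ) (c θ) (x θ) := by
  refine ProbabilityMeasure.continuous_iff_forall_continuousMap_continuous_integral.2 fun g => ?_
  simp only [integral_starMeasure (hm _) (hs _)]
  refine Continuous.add ?_ ?_
  · exact continuous_finsetSum _ fun i hi => (hmc i hi).mul (g.continuous.comp (hcc i hi))
  · exact (continuous_const.sub (continuous_finsetSum _ hmc)).mul (g.continuous.comp hx)

end

/-! ### Compactness -/

/-- The measures given by a heavy point, `n` light points and `n` small masses form a compact
set. -/
theorem exists_isCompact_card_atoms (n : ℕ) : ∃ K : Set (ProbabilityMeasure X), IsCompact K ∧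
    {μ | μ ∈ Pf X ∧ (atoms μ).card = n + 1} ⊆ K ∧
    K ⊆ {μ | μ ∈ Pf X ∧ (atoms μ).card ≤ n + 1} := by
  classical
  set K : Set (X × (Fin n → X) × (Fin n → ℝ)) :=
    univ ×ˢ univ ×ˢ {m | (∀ i, 0 ≤ m i) ∧ ∑ i, m i ≤ 1 / (n + 2 : ℝ)} with hK
  have hn2 : (1 : ℝ) / (n + 2) ≤ 1 :=
    (div_le_one (by positivity)).2 (by linarith [(n.cast_nonneg : (0 : ℝ) ≤ n)])
  have hKc : IsCompact K := by
    refine isCompact_univ.prod (isCompact_univ.prod ?_)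
    refine IsCompact.of_isClosed_subset (isCompact_univ_pi fun _ : Fin n => isCompact_Icc)
      (s := univ.pi fun _ : Fin n => Icc (0 : ℝ) 1) ?_ ?_
    · refine IsClosed.inter ?_ ?_
      · change IsClosed {m : Fin n → ℝ | ∀ i, 0 ≤ m i}
        rw [ofPred_forall]
        exact isClosed_iInter fun i => isClosed_le continuous_const (continuous_apply i)
      · exact isClosed_le (continuous_finsetSum _ fun i _ => continuous_apply i) continuous_const
    · intro m hm i _
      exact ⟨hm.1 i, ((Finset.single_le_sum (fun j _ => hm.1 j) (Finset.mem_univ i)).trans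
        hm.2).trans hn2⟩
  set Ψ : X × (Fin n → X) × (Fin n → ℝ) → ProbabilityMeasure X :=
    fun p => starMeasure Finset.univ p.2.2 p.2.1 p.1 with hΨ
  have hΨc : ContinuousOn Ψ K := by
    rw [continuousOn_iff_continuous_domRestrict]
    refine continuous_starMeasure (Θ := K) (m := fun p => p.1.2.2) (c := fun p => p.1.2.1)
      (x := fun p => p.1.1) (fun p i _ => p.2.2.2.1 i) (fun p => p.2.2.2.2.trans hn2)
      (fun i _ => ?_) (fun i _ => ?_) ?_ <;> fun_prop
  refine ⟨Ψ '' K, hKc.image_of_continuousOn hΨc, ?_, ?_⟩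
  · rintro μ ⟨hμ, hcard⟩
    have hlight : ((atoms μ).erase (heavy μ)).card = n := by
      rw [Finset.card_erase_of_mem (heavy_mem_atoms hμ), hcard, Nat.add_sub_cancel]
    have e := (((atoms μ).erase (heavy μ)).equivFinOfCardEq hlight).symm
    have himg : Finset.univ.image (fun i => (e i : X)) = (atoms μ).erase (heavy μ) := by
      ext z
      simp only [Finset.mem_image, Finset.mem_univ, true_and]
      exact ⟨by rintro ⟨i, rfl⟩; exact (e i).2, fun hz => ⟨e.symm ⟨z, hz⟩, by simp⟩⟩
    have hinj : InjOn (fun i => (e i : X)) (Finset.univ : Finset (Fin n)) :=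
      (Subtype.val_injective.comp e.injective).injOn
    refine ⟨(heavy μ, fun i => e i, fun i => (μ : Measure X).real {(e i : X)}),
      ⟨mem_univ _, mem_univ _, fun i => measureReal_nonneg, ?_⟩, eq_starMeasure hμ hinj himg⟩
    have h1 := sum_real_eq_one (measure_compl_atoms (finite_support hμ))
    rw [← Finset.add_sum_erase _ _ (heavy_mem_atoms hμ), ← himg, Finset.sum_image hinj] at h1
    have h2 := one_sub_le_real_heavy hμ
    rw [hcard] at h2
    push_cast at h2
    rw [add_assoc, one_add_one_eq_two] at h2
    dsimp only
    linarith
  · rintro _ ⟨p, hp, rfl⟩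
    exact starMeasure_mem (c := p.2.1) (x := p.1) (s := Finset.univ) (n := n)
      (fun i _ => hp.2.2.1 i) (by simp) hp.2.2.2

theorem isCompact_card_atoms_le (n : ℕ) :
    IsCompact {μ : ProbabilityMeasure X | μ ∈ Pf X ∧ (atoms μ).card ≤ n} := by
  choose K hK h1 h2 using exists_isCompact_card_atoms (X := X)
  have : {μ : ProbabilityMeasure X | μ ∈ Pf X ∧ (atoms μ).card ≤ n} =
      ⋃ j ∈ Finset.range n, K j := by
    ext μ
    simp only [mem_iUnion, Finset.mem_range, exists_prop]
    constructor
    · rintro ⟨hμ, hn⟩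
      have := card_atoms_pos hμ
      exact ⟨(atoms μ).card - 1, by omega, h1 _ ⟨hμ, by omega⟩⟩
    · rintro ⟨j, hj, hμ⟩
      exact ⟨(h2 j hμ).1, (h2 j hμ).2.trans (by omega)⟩
  rw [this]
  exact (Finset.range n).isCompact_biUnion fun j _ => hK j

theorem isCompact_Pf : IsCompact (Pf X) := by
  classical
  refine isCompact_iff_ultrafilter_le_nhds.2 fun U hU => ?_
  by_cases h : ∃ n, {μ : ProbabilityMeasure X | μ ∈ Pf X ∧ (atoms μ).card ≤ n} ∈ U
  · obtain ⟨n, hn⟩ := h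
    obtain ⟨μ, hμ, hUμ⟩ := isCompact_iff_ultrafilter_le_nhds.1
      (isCompact_card_atoms_le (X := X) n) U (le_principal_iff.2 hn)
    exact ⟨μ, hμ.1, hUμ⟩
  -- otherwise the mass of the heavy point tends to one along the ultrafilter
  have hPf : Pf X ∈ U := le_principal_iff.1 hU
  have hlarge : ∀ n : ℕ, ∀ᶠ μ in U, μ ∈ Pf X ∧ n < (atoms μ).card := by
    intro n
    have h1 : {μ : ProbabilityMeasure X | μ ∈ Pf X ∧ (atoms μ).card ≤ n}ᶜ ∈ U :=
      Ultrafilter.compl_mem_iff_notMem.2 fun hn => h ⟨n, hn⟩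
    filter_upwards [hPf, h1] with μ hμ hμn
    exact ⟨hμ, not_le.1 fun hle => hμn ⟨hμ, hle⟩⟩
  obtain ⟨x, -, hx⟩ := isCompact_iff_ultrafilter_le_nhds.1 (isCompact_univ (X := X))
    (U.map heavy) (by simp)
  have hx' : Tendsto heavy U (𝓝 x) := hx
  refine ⟨⟨Measure.dirac x, Measure.dirac.isProbabilityMeasure⟩, ?_, ?_⟩
  · refine (mem_Pf_of_finset (F := {x}) (x := x) (n := 1) one_pos ?_ (by simp) ?_).1
    · change Measure.dirac x _ = 0
      rw [Measure.dirac_apply' _ (Finset.measurableSet _).compl]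
      simp
    · change _ ≤ (Measure.dirac x).real {x}
      simp [measureReal_def]
  · change Tendsto id (U : Filter (ProbabilityMeasure X)) _
    refine ProbabilityMeasure.tendsto_iff_forall_integral_tendsto.2 fun g => ?_
    change Tendsto _ _ (𝓝 (∫ z, g z ∂Measure.dirac x))
    rw [integral_dirac]
    have h1 : Tendsto (fun μ => g (heavy μ)) U (𝓝 (g x)) := (g.continuous.tendsto x).comp hx'
    have h2 : Tendsto (fun μ : ProbabilityMeasure X =>
        ∫ z, (g z - g (heavy μ)) ∂(μ : Measure X)) U (𝓝 0) := by
      refine Metric.tendsto_nhds.2 fun ε hε => ?_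
      obtain ⟨n, hn⟩ := exists_nat_gt (2 * ‖g‖ / ε)
      filter_upwards [hlarge n] with μ hμ
      obtain ⟨hμ, hcard⟩ := hμ
      have hc := measure_compl_atoms (finite_support hμ)
      have h3 := sum_real_eq_one hc
      have h4 := one_sub_le_real_heavy hμ
      rw [dist_zero_right, integral_eq_sum hc]
      rw [← Finset.add_sum_erase _ _ (heavy_mem_atoms hμ)] at h3 ⊢
      rw [sub_self, mul_zero, zero_add]
      have h5 : ‖∑ z ∈ (atoms μ).erase (heavy μ), (μ : Measure X).real {z} * (g z - g (heavy μ))‖ ≤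
          ∑ z ∈ (atoms μ).erase (heavy μ), (μ : Measure X).real {z} * (2 * ‖g‖) := by
        refine norm_sum_le_of_le _ fun z _ => ?_
        rw [norm_mul, Real.norm_of_nonneg measureReal_nonneg]
        refine mul_le_mul_of_nonneg_left ?_ measureReal_nonneg
        rw [← dist_eq_norm]
        exact g.dist_le_two_norm z _
      rw [← Finset.sum_mul] at h5
      refine h5.trans_lt ?_
      have h6 : (n : ℝ) < (atoms μ).card + 1 := by
        have : (n : ℝ) < (atoms μ).card := by exact_mod_cast hcard
        linarith
      have h7 : ∑ z ∈ (atoms μ).erase (heavy μ), (μ : Measure X).real {z} ≤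
          1 / ((atoms μ).card + 1) := by linarith
      refine (mul_le_mul_of_nonneg_right h7 (by positivity)).trans_lt ?_
      rw [one_div_mul_eq_div, div_lt_iff₀ (by positivity)]
      rw [div_lt_iff₀ hε] at hn
      nlinarith
    have h3 := h2.add h1
    rw [zero_add] at h3
    refine h3.congr fun μ => ?_
    rw [integral_sub (g.integrable _) (integrable_const _)]
    simp

/-! ### Transporting atoms -/

variable {Q : Type w} [TopologicalSpace Q] [MetrizableSpace Q] [CompactSpace Q] [MeasurableSpace Q]
  [BorelSpace Q]

/-- Of the mass at an atom `z` of `μ`, the part `a z` is moved to `T z` and the rest to `x`. -/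
noncomputable def transport (a : Q → ℝ) (T : Q → X) (x : X) (μ : ProbabilityMeasure Q) :
    ProbabilityMeasure X :=
  starMeasure (atoms μ) (fun z => (μ : Measure Q).real {z} * a z) T x

section
variable {a : Q → ℝ} {T : Q → X} {x : X} {μ : ProbabilityMeasure Q}

theorem sum_transport_le_one (hμ : (μ : Measure Q).support.Finite) (ha1 : ∀ z, a z ≤ 1) :
    ∑ z ∈ atoms μ, (μ : Measure Q).real {z} * a z ≤ 1 := by
  rw [← sum_real_eq_one (measure_compl_atoms hμ)]
  exact Finset.sum_le_sum fun z _ => mul_le_of_le_one_right measureReal_nonneg (ha1 z)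

theorem integral_transport (hμ : (μ : Measure Q).support.Finite) (ha0 : ∀ z, 0 ≤ a z)
    (ha1 : ∀ z, a z ≤ 1) (g : X → ℝ) :
    ∫ z, g z ∂(transport a T x μ : Measure X) =
      ∫ z, (a z * g (T z) + (1 - a z) * g x) ∂(μ : Measure Q) := by
  rw [transport, integral_starMeasure (fun z _ => mul_nonneg measureReal_nonneg (ha0 z))
    (sum_transport_le_one hμ ha1), integral_eq_sum (measure_compl_atoms hμ)]
  have h1 := sum_real_eq_one (measure_compl_atoms hμ)
  simp only [mul_add, Finset.sum_add_distrib, mul_sub, sub_mul, one_mul,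
    Finset.sum_sub_distrib, mul_assoc]
  simp only [← mul_assoc, ← Finset.sum_mul]
  rw [h1]
  ring

theorem finite_support_transport (hμ : (μ : Measure Q).support.Finite) (ha0 : ∀ z, 0 ≤ a z)
    (ha1 : ∀ z, a z ≤ 1) : (transport a T x μ : Measure X).support.Finite :=
  finite_support_starMeasure (fun z _ => mul_nonneg measureReal_nonneg (ha0 z))
    (sum_transport_le_one hμ ha1)

theorem mem_atoms_transport (hμ : (μ : Measure Q).support.Finite) (ha0 : ∀ z, 0 ≤ a z)
    (ha1 : ∀ z, a z ≤ 1) {z : Q} (hz : z ∈ atoms μ) (haz : 0 < a z) :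
    T z ∈ atoms (transport a T x μ) := by
  rw [mem_atoms (finite_support_transport hμ ha0 ha1)]
  refine lt_of_lt_of_le (mul_pos ((mem_atoms hμ).1 hz) haz) ?_
  exact le_real_starMeasure (c := T) (x := x) (fun z _ => mul_nonneg measureReal_nonneg (ha0 z))
    (sum_transport_le_one hμ ha1) hz

theorem measure_compl_transport [DecidableEq X] (hμ : (μ : Measure Q).support.Finite)
    (ha0 : ∀ z, 0 ≤ a z) (ha1 : ∀ z, a z ≤ 1) {F : Finset X} (hx : x ∈ F)
    (hF : ∀ z ∈ atoms μ, 0 < a z → T z ∈ F) :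
    (transport a T x μ : Measure X) (F : Set X)ᶜ = 0 := by
  have h := real_starMeasure (c := T) (x := x) (s := atoms μ)
    (fun z _ => mul_nonneg measureReal_nonneg (ha0 z)) (sum_transport_le_one hμ ha1)
  have hfin := finite_support_transport (T := T) (x := x) hμ ha0 ha1
  refine measure_mono_null (compl_subset_compl.2 (Finset.coe_subset.2 fun y hy => ?_))
    (measure_compl_atoms hfin)
  by_contra hyF
  refine ((mem_atoms hfin).1 hy).ne' ?_
  have hxy : x ≠ y := fun hxy => hyF (hxy ▸ hx)
  rw [transport, h, if_neg hxy, add_zero]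
  refine Finset.sum_eq_zero fun z hz => ?_
  split_ifs with hzy
  · rw [le_antisymm (not_lt.1 fun haz => hyF (hzy ▸ hF z hz haz)) (ha0 z), mul_zero]
  · rfl

theorem transport_mem (hμ : μ ∈ Pf Q) (ha0 : ∀ z, 0 ≤ a z) (ha1 : ∀ z, a z ≤ 1)
    (hT : T (heavy μ) = x) :
    transport a T x μ ∈ Pf X ∧ (atoms (transport a T x μ)).card ≤ (atoms μ).card ∧
      heavy (transport a T x μ) = x := by
  classical
  have hfin := finite_support hμ
  have hh := heavy_mem_atoms hμ
  have hle : (μ : Measure Q).real {heavy μ} ≤ (transport a T x μ : Measure X).real {x} := by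
    rw [transport, real_starMeasure (fun z _ => mul_nonneg measureReal_nonneg (ha0 z))
      (sum_transport_le_one hfin ha1), if_pos rfl]
    have h1 : (μ : Measure Q).real {heavy μ} * a (heavy μ) ≤
        ∑ z ∈ atoms μ, if T z = x then (μ : Measure Q).real {z} * a z else 0 := by
      have h := Finset.single_le_sum
        (f := fun z => if T z = x then (μ : Measure Q).real {z} * a z else 0)
        (fun z _ => by
          split_ifs <;> [exact mul_nonneg measureReal_nonneg (ha0 z); exact le_rfl]) hh
      rwa [if_pos hT] at h
    have h2 := sum_real_eq_one (measure_compl_atoms hfin)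
    have h4 := Finset.add_sum_erase (atoms μ) (fun z => (μ : Measure Q).real {z} * a z) hh
    rw [← Finset.add_sum_erase _ _ hh] at h2
    have h3 : ∑ z ∈ (atoms μ).erase (heavy μ), (μ : Measure Q).real {z} * a z ≤
        ∑ z ∈ (atoms μ).erase (heavy μ), (μ : Measure Q).real {z} :=
      Finset.sum_le_sum fun z _ => mul_le_of_le_one_right measureReal_nonneg (ha1 z)
    linarith
  have h1 := mem_Pf_of_finset (μ := transport a T x μ) (F := (atoms μ).image T) (x := x)
    (card_atoms_pos hμ)
    (measure_compl_transport hfin ha0 ha1 (hT ▸ Finset.mem_image_of_mem T hh)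
      fun z hz _ => Finset.mem_image_of_mem T hz)
    Finset.card_image_le ((one_sub_le_real_heavy hμ).trans hle)
  exact ⟨h1.1, h1.2, heavy_eq ((le_real_heavy hμ).trans hle)⟩

/-- A transport that keeps the mass of every atom in place is the identity. -/
theorem transport_eq_self {a : Q → ℝ} {T : Q → Q} {x : Q} (hμ : (μ : Measure Q).support.Finite)
    (ha0 : ∀ z, 0 ≤ a z) (ha1 : ∀ z, a z ≤ 1)
    (h : ∀ z ∈ atoms μ, (a z = 1 ∨ z = x) ∧ T z = z) : transport a T x μ = μ := by
  refine eq_of_forall_integral_eq fun g _ => ?_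
  rw [integral_transport hμ ha0 ha1, integral_eq_sum (measure_compl_atoms hμ),
    integral_eq_sum (measure_compl_atoms hμ)]
  refine Finset.sum_congr rfl fun z hz => ?_
  obtain ⟨h1, h2⟩ := h z hz
  rw [h2]
  rcases h1 with h1 | h1
  · rw [h1]; ring
  · rw [h1]; ring

end

theorem continuous_transport {Θ : Type*} [TopologicalSpace Θ] {a : Θ → Q → ℝ} {T : Θ → Q → X}
    {x : Θ → X} {μ : Θ → ProbabilityMeasure Q} (hμ : Continuous μ)
    (hfin : ∀ θ, (μ θ : Measure Q).support.Finite) (ha0 : ∀ θ z, 0 ≤ a θ z)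
    (ha1 : ∀ θ z, a θ z ≤ 1) (hx : Continuous x) (ha : Continuous fun p : Θ × Q => a p.1 p.2)
    (hT : ∀ g : X → ℝ, Continuous g → Continuous fun p : Θ × Q => a p.1 p.2 * g (T p.1 p.2)) :
    Continuous fun θ => transport (a θ) (T θ) (x θ) (μ θ) := by
  refine ProbabilityMeasure.continuous_iff_forall_continuousMap_continuous_integral.2 fun g => ?_
  simp only [integral_transport (hfin _) (ha0 _) (ha1 _)]
  refine continuous_integral_of_jointly hμ
    (g := fun θ z => a θ z * g (T θ z) + (1 - a θ z) * g (x θ)) ?_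
  exact (hT g g.continuous).add ((continuous_const.sub ha).mul
    (g.continuous.comp (hx.comp continuous_fst)))
end

section
open Set Filter
universe v w

/-! ### Clusters in the Hilbert cube -/

/-- The Hilbert cube. -/
abbrev Cube := ℕ → unitInterval

/-- The distance, in units of `ε`, of the first `n` coordinates of two points of the cube. -/
noncomputable def cubeDist (n : ℕ) (ε : ℝ) (z w : Cube) : ℝ :=
  dist (fun l : Fin n => (z l : ℝ)) (fun l : Fin n => (w l : ℝ)) / ε

/-- The piecewise linear function equal to `1` on `(-∞, k]` and to `0` on `[k + 1, ∞)`. -/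
noncomputable def cutoff (k r : ℝ) : ℝ := max 0 (min 1 (k + 1 - r))

theorem continuous_cutoff (k : ℝ) : Continuous (cutoff k) := by
  unfold cutoff
  fun_prop

theorem cutoff_nonneg (k r : ℝ) : 0 ≤ cutoff k r := le_max_left _ _

theorem cutoff_le_one (k r : ℝ) : cutoff k r ≤ 1 := max_le zero_le_one (min_le_left _ _)

theorem cutoff_eq_one {k r : ℝ} (h : r ≤ k) : cutoff k r = 1 := by
  rw [cutoff, min_eq_left (by linarith), max_eq_right zero_le_one]

theorem cutoff_eq_zero {k r : ℝ} (h : k + 1 ≤ r) : cutoff k r = 0 :=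
  max_eq_left ((min_le_right _ _).trans (by linarith))

theorem cutoff_pos_iff {k r : ℝ} : 0 < cutoff k r ↔ r < k + 1 := by
  rw [cutoff, lt_max_iff, lt_min_iff]
  simp

section
variable {n : ℕ} {ε : ℝ}

theorem continuous_cubeDist (z : Cube) : Continuous (cubeDist n ε z) := by
  unfold cubeDist
  refine Continuous.div_const (continuous_const.dist (continuous_pi fun l => ?_)) _
  exact continuous_subtype_val.comp (continuous_apply _)

theorem cubeDist_self (z : Cube) : cubeDist n ε z z = 0 := by simp [cubeDist]

theorem cubeDist_le_iff (hε : 0 < ε) {z w : Cube} {R : ℝ} (hR : 0 ≤ R) :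
    cubeDist n ε z w ≤ R ↔ ∀ l < n, |(w l : ℝ) - z l| ≤ R * ε := by
  rw [cubeDist, div_le_iff₀ hε, dist_pi_le_iff (mul_nonneg hR hε.le)]
  simp only [Real.dist_eq, abs_sub_comm]
  exact ⟨fun h l hl => h ⟨l, hl⟩, fun h l => h l l.2⟩

theorem cubeDist_triangle (hε : 0 < ε) (z z' w : Cube) :
    cubeDist n ε z z' ≤ cubeDist n ε z w + cubeDist n ε z' w := by
  rw [cubeDist, cubeDist, cubeDist, ← add_div]
  exact div_le_div_of_nonneg_right (dist_triangle_right _ _ _) hε.le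

/-- Finitely many points of the cube are well separated by finitely many coordinates. -/
theorem exists_cubeDist_ge (F : Finset Cube) (R : ℝ) :
    ∃ n ε, 0 < ε ∧ ∀ z ∈ F, ∀ z' ∈ F, z ≠ z' → R ≤ cubeDist n ε z z' := by
  have h1 : ∀ z z' : Cube, ∃ l, z ≠ z' → z l ≠ z' l := fun z z' => by
    by_cases h : z = z'
    · exact ⟨0, fun h' => (h' h).elim⟩
    · obtain ⟨l, hl⟩ := Function.ne_iff.1 h
      exact ⟨l, fun _ => hl⟩
  choose l hl using h1
  obtain ⟨n, hn⟩ : ∃ n, ∀ z ∈ F, ∀ z' ∈ F, l z z' < n := by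
    refine ⟨(F ×ˢ F).sup (fun p => l p.1 p.2) + 1, fun z hz z' hz' => Nat.lt_succ_of_le ?_⟩
    exact Finset.le_sup (f := fun p : Cube × Cube => l p.1 p.2)
      (Finset.mem_product.2 ⟨hz, hz'⟩ : (z, z') ∈ F ×ˢ F)
  have hpos : ∀ z ∈ F, ∀ z' ∈ F, z ≠ z' →
      0 < dist (fun l : Fin n => (z l : ℝ)) (fun l : Fin n => (z' l : ℝ)) := by
    intro z hz z' hz' hne
    refine dist_pos.2 fun h => hl z z' hne (Subtype.ext ?_)
    exact congrFun h ⟨l z z', hn z hz z' hz'⟩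
  have h2 : ∃ ε : ℝ, 0 < ε ∧ ∀ p ∈ F ×ˢ F, p.1 ≠ p.2 →
      (|R| + 1) * ε ≤ dist (fun l : Fin n => (p.1 l : ℝ)) (fun l : Fin n => (p.2 l : ℝ)) := by
    have h3 : ∀ p ∈ F ×ˢ F, ∀ᶠ ε in 𝓝[>] (0 : ℝ), p.1 ≠ p.2 →
        (|R| + 1) * ε ≤ dist (fun l : Fin n => (p.1 l : ℝ)) (fun l : Fin n => (p.2 l : ℝ)) := by
      intro p hp
      by_cases hne : p.1 = p.2
      · exact Eventually.of_forall fun ε h => (h hne).elim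
      · rw [Finset.mem_product] at hp
        have hlim : Tendsto (fun ε : ℝ => (|R| + 1) * ε) (𝓝[>] 0) (𝓝 0) := by
          have : Tendsto (fun ε : ℝ => (|R| + 1) * ε) (𝓝 0) (𝓝 ((|R| + 1) * 0)) :=
            (continuous_const.mul continuous_id).tendsto 0
          rw [mul_zero] at this
          exact this.mono_left nhdsWithin_le_nhds
        filter_upwards [hlim.eventually (gt_mem_nhds (hpos _ hp.1 _ hp.2 hne))] with ε h _
        exact h.le
    obtain ⟨ε, h4, h5⟩ := (((Finset.eventually_all _).2 h3).and self_mem_nhdsWithin).exists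
    exact ⟨ε, h5, h4⟩
  obtain ⟨ε, hε, h⟩ := h2
  refine ⟨n, ε, hε, fun z hz z' hz' hne => ?_⟩
  rw [cubeDist, le_div_iff₀ hε]
  refine le_trans ?_ (h (z, z') (Finset.mem_product.2 ⟨hz, hz'⟩) hne)
  exact mul_le_mul_of_nonneg_right (by linarith [le_abs_self R]) hε.le

end

/-- The barycenter of the measure `μ` weighted with the function `g`. -/
noncomputable def barycenter (g : Cube → ℝ) (μ : ProbabilityMeasure Cube) : Cube := fun l =>
  projIcc 0 1 zero_le_one
    ((∫ w, g w * w l ∂(μ : Measure Cube)) / ∫ w, g w ∂(μ : Measure Cube))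

theorem barycenter_mem_Icc {g : Cube → ℝ} {μ : ProbabilityMeasure Cube}
    (hμ : (μ : Measure Cube).support.Finite) (hg : ∀ w, 0 ≤ g w)
    (hpos : 0 < ∫ w, g w ∂(μ : Measure Cube)) {l : ℕ} {α β : ℝ}
    (h : ∀ w ∈ atoms μ, 0 < g w → (w l : ℝ) ∈ Icc α β) :
    (barycenter g μ l : ℝ) ∈ Icc α β := by
  have key : ∀ α β : ℝ, (∀ w ∈ atoms μ, 0 < g w → (w l : ℝ) ∈ Icc α β) →
      (∫ w, g w * w l ∂(μ : Measure Cube)) / ∫ w, g w ∂(μ : Measure Cube) ∈ Icc α β := by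
    intro α β h
    have h0 : ∀ w ∈ atoms μ, g w * α ≤ g w * w l ∧ g w * w l ≤ g w * β := by
      intro w hw
      rcases (hg w).eq_or_lt with h0 | h0
      · simp [← h0]
      · exact ⟨mul_le_mul_of_nonneg_left (h w hw h0).1 h0.le,
          mul_le_mul_of_nonneg_left (h w hw h0).2 h0.le⟩
    rw [mem_Icc, le_div_iff₀ hpos, div_le_iff₀ hpos]
    rw [integral_eq_sum (measure_compl_atoms hμ), integral_eq_sum (measure_compl_atoms hμ),
      Finset.mul_sum, Finset.mul_sum]
    constructor
    · refine Finset.sum_le_sum fun w hw => ?_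
      have := mul_le_mul_of_nonneg_left (h0 w hw).1
        (measureReal_nonneg (μ := (μ : Measure Cube)) (s := {w}))
      linarith
    · refine Finset.sum_le_sum fun w hw => ?_
      have := mul_le_mul_of_nonneg_left (h0 w hw).2
        (measureReal_nonneg (μ := (μ : Measure Cube)) (s := {w}))
      linarith
  rw [barycenter, projIcc_of_mem zero_le_one (key 0 1 fun w _ _ => (w l).2)]
  exact key α β h

theorem barycenter_eq {g : Cube → ℝ} {μ : ProbabilityMeasure Cube}
    (hμ : (μ : Measure Cube).support.Finite) (hg : ∀ w, 0 ≤ g w)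
    (hpos : 0 < ∫ w, g w ∂(μ : Measure Cube)) {y : Cube}
    (h : ∀ w ∈ atoms μ, 0 < g w → w = y) : barycenter g μ = y := by
  funext l
  have := barycenter_mem_Icc hμ hg hpos (l := l) (α := y l) (β := y l)
    fun w hw hgw => by rw [h w hw hgw]; exact ⟨le_rfl, le_rfl⟩
  exact Subtype.ext (le_antisymm this.2 this.1)

theorem cubeDist_barycenter_le {n : ℕ} {ε : ℝ} (hε : 0 < ε) {g : Cube → ℝ}
    {μ : ProbabilityMeasure Cube} (hμ : (μ : Measure Cube).support.Finite) (hg : ∀ w, 0 ≤ g w)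
    (hpos : 0 < ∫ w, g w ∂(μ : Measure Cube)) {z : Cube} {R : ℝ} (hR : 0 ≤ R)
    (h : ∀ w ∈ atoms μ, 0 < g w → cubeDist n ε z w ≤ R) :
    cubeDist n ε z (barycenter g μ) ≤ R := by
  rw [cubeDist_le_iff hε hR]
  intro l hl
  have := barycenter_mem_Icc hμ hg hpos (l := l) (α := z l - R * ε) (β := z l + R * ε)
    fun w hw hgw => by
      have := abs_le.1 ((cubeDist_le_iff hε hR).1 (h w hw hgw) l hl)
      exact ⟨by linarith [this.1], by linarith [this.2]⟩
  exact abs_le.2 ⟨by linarith [this.1], by linarith [this.2]⟩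

theorem continuousOn_barycenter {g : Cube → ℝ} (hg : Continuous g) :
    ContinuousOn (barycenter g)
      {μ : ProbabilityMeasure Cube | 0 < ∫ w, g w ∂(μ : Measure Cube)} := by
  refine continuousOn_pi.2 fun l => continuous_projIcc.comp_continuousOn ?_
  refine ContinuousOn.div (continuous_integral ?_).continuousOn
    (continuous_integral hg).continuousOn fun μ hμ => ne_of_gt hμ
  exact hg.mul (continuous_subtype_val.comp (continuous_apply l))

/-! ### The cluster deformation -/

/-- The fraction of the mass at `w` that is not moved to the heavy point by time `t`. It equals `1`
in the clusters around the points of `L` and, for `t ≥ 1 / 2`, vanishes away from them. -/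
noncomputable def clusterMass (n : ℕ) (ε : ℝ) (L : Finset Cube) (t : ℝ) (w : Cube) : ℝ :=
  1 - min 1 (2 * t) * (1 - ∑ z ∈ L, cutoff 1 (cubeDist n ε z w))

/-- The motion of the atoms of `μ` in the clusters towards the barycenters of the clusters. -/
noncomputable def clusterMove (n : ℕ) (ε : ℝ) (L : Finset Cube) (t : ℝ)
    (μ : ProbabilityMeasure Cube) (w : Cube) : Cube := fun l =>
  projIcc 0 1 zero_le_one (w l + max 0 (2 * t - 1) * ∑ z ∈ L, cutoff 2 (cubeDist n ε z w) *
    ((barycenter (fun w => cutoff 1 (cubeDist n ε z w)) μ l : ℝ) - w l))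

/-- The deformation of a measure whose light mass is mostly clustered around the points of `L`.
During the first half of the time the light mass far from `L` is moved to the heavy point, during
the second half each cluster is contracted to its barycenter. -/
noncomputable def clusterDeformation (n : ℕ) (ε : ℝ) (L : Finset Cube) (t : ℝ)
    (μ : ProbabilityMeasure Cube) : ProbabilityMeasure Cube :=
  transport (clusterMass n ε L t) (clusterMove n ε L t μ) (heavy μ) μ

section
variable {n : ℕ} {ε : ℝ} {L : Finset Cube}
  (hsep : ∀ z ∈ L, ∀ z' ∈ L, z ≠ z' → 8 ≤ cubeDist n ε z z')

include hsep in
/-- The balls of radius `4` around the points of `L` are disjoint. The cutoffs at the radii `1`, `2`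
and `3` vanish outside of these balls, so at each point at most one cluster matters. -/
theorem four_lt_of_lt_four (hε : 0 < ε) {z z' w : Cube} (hz : z ∈ L) (hz' : z' ∈ L) (hne : z ≠ z')
    (h : cubeDist n ε z w < 4) : 4 < cubeDist n ε z' w := by
  have h1 := cubeDist_triangle (n := n) hε z z' w
  have h2 := hsep z hz z' hz' hne
  linarith

include hsep in
theorem sum_cutoff_eq (hε : 0 < ε) {k : ℝ} (hk : k ≤ 3) {z w : Cube} (hz : z ∈ L)
    (h : cubeDist n ε z w < 4) (f : Cube → ℝ) :
    ∑ z ∈ L, cutoff k (cubeDist n ε z w) * f z = cutoff k (cubeDist n ε z w) * f z := by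
  refine Finset.sum_eq_single_of_mem z hz fun z' hz' hne => ?_
  have := four_lt_of_lt_four hsep hε hz hz' hne.symm h
  rw [cutoff_eq_zero (by linarith), zero_mul]

theorem sum_cutoff_eq_zero {k : ℝ} (hk : k ≤ 3) {w : Cube}
    (h : ∀ z ∈ L, 4 ≤ cubeDist n ε z w) (f : Cube → ℝ) :
    ∑ z ∈ L, cutoff k (cubeDist n ε z w) * f z = 0 :=
  Finset.sum_eq_zero fun z hz => by rw [cutoff_eq_zero (by linarith [h z hz]), zero_mul]

include hsep in
theorem sum_cutoff_le_one (hε : 0 < ε) (w : Cube) :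
    ∑ z ∈ L, cutoff 1 (cubeDist n ε z w) ≤ 1 := by
  by_cases h : ∃ z ∈ L, cubeDist n ε z w < 4
  · obtain ⟨z, hz, hzw⟩ := h
    have := sum_cutoff_eq hsep hε (k := 1) (by norm_num) hz hzw fun _ => 1
    simp only [mul_one] at this
    rw [this]
    exact cutoff_le_one _ _
  · push Not at h
    have := sum_cutoff_eq_zero (k := 1) (by norm_num) h fun _ => 1
    simp only [mul_one] at this
    rw [this]
    exact zero_le_one

include hsep in
theorem clusterMass_nonneg (hε : 0 < ε) {t : ℝ} (ht : 0 ≤ t) (w : Cube) :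
    0 ≤ clusterMass n ε L t w := by
  have h1 : 0 ≤ ∑ z ∈ L, cutoff 1 (cubeDist n ε z w) :=
    Finset.sum_nonneg fun z _ => cutoff_nonneg _ _
  have h2 : 0 ≤ min 1 (2 * t) := le_min zero_le_one (by linarith)
  have h3 : min 1 (2 * t) ≤ 1 := min_le_left _ _
  have h4 := sum_cutoff_le_one hsep hε w
  rw [clusterMass]
  nlinarith

include hsep in
theorem clusterMass_le_one (hε : 0 < ε) {t : ℝ} (ht : 0 ≤ t) (w : Cube) :
    clusterMass n ε L t w ≤ 1 := by
  have h2 : 0 ≤ min 1 (2 * t) := le_min zero_le_one (by linarith)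
  have h4 := sum_cutoff_le_one hsep hε w
  rw [clusterMass]
  nlinarith

include hsep in
theorem clusterMass_eq_one (hε : 0 < ε) {t : ℝ} {z w : Cube} (hz : z ∈ L)
    (h : cubeDist n ε z w ≤ 1) : clusterMass n ε L t w = 1 := by
  have := sum_cutoff_eq hsep hε (k := 1) (by norm_num) hz (by linarith : cubeDist n ε z w < 4)
    fun _ => 1
  simp only [mul_one] at this
  rw [clusterMass, this, cutoff_eq_one h]
  ring

theorem clusterMass_zero (w : Cube) : clusterMass n ε L 0 w = 1 := by simp [clusterMass]

theorem clusterMass_one (w : Cube) :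
    clusterMass n ε L 1 w = ∑ z ∈ L, cutoff 1 (cubeDist n ε z w) := by
  rw [clusterMass, min_eq_left (by norm_num)]
  ring

theorem clusterMove_zero (μ : ProbabilityMeasure Cube) (w : Cube) :
    clusterMove n ε L 0 μ w = w := by
  funext l
  rw [clusterMove, max_eq_left (by norm_num), zero_mul, add_zero, projIcc_val]

theorem clusterMove_of_far {t : ℝ} (μ : ProbabilityMeasure Cube) {w : Cube}
    (h : ∀ z ∈ L, 4 ≤ cubeDist n ε z w) : clusterMove n ε L t μ w = w := by
  funext l
  rw [clusterMove, sum_cutoff_eq_zero (by norm_num) h, mul_zero, add_zero, projIcc_val]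

include hsep in
theorem coe_clusterMove (hε : 0 < ε) {t : ℝ} (ht : t ≤ 1) (μ : ProbabilityMeasure Cube)
    {z w : Cube} (hz : z ∈ L) (h : cubeDist n ε z w ≤ 2) (l : ℕ) :
    (clusterMove n ε L t μ w l : ℝ) = w l + max 0 (2 * t - 1) *
      ((barycenter (fun w => cutoff 1 (cubeDist n ε z w)) μ l : ℝ) - w l) := by
  rw [clusterMove, sum_cutoff_eq hsep hε (by norm_num) hz (by linarith), cutoff_eq_one h, one_mul,
    projIcc_of_mem zero_le_one]
  have h0 : 0 ≤ max 0 (2 * t - 1) := le_max_left _ _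
  have h1 : max 0 (2 * t - 1) ≤ 1 := max_le zero_le_one (by linarith)
  have h2 := (w l).2
  have h3 := (barycenter (fun w => cutoff 1 (cubeDist n ε z w)) μ l).2
  constructor
  · nlinarith [h2.1, h3.1]
  · nlinarith [h2.2, h3.2]

include hsep in
theorem clusterMove_one (hε : 0 < ε) (μ : ProbabilityMeasure Cube) {z w : Cube} (hz : z ∈ L)
    (h : cubeDist n ε z w ≤ 2) :
    clusterMove n ε L 1 μ w = barycenter (fun w => cutoff 1 (cubeDist n ε z w)) μ := by
  funext l
  refine Subtype.ext ?_
  rw [coe_clusterMove hsep hε le_rfl μ hz h, max_eq_right (by norm_num)]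
  ring

include hsep in
theorem clusterMove_of_eq (hε : 0 < ε) {t : ℝ} (ht : t ≤ 1) {μ : ProbabilityMeasure Cube}
    {z w : Cube} (hz : z ∈ L) (h : cubeDist n ε z w ≤ 2)
    (hw : barycenter (fun w => cutoff 1 (cubeDist n ε z w)) μ = w) :
    clusterMove n ε L t μ w = w := by
  funext l
  refine Subtype.ext ?_
  rw [coe_clusterMove hsep hε ht μ hz h, hw, sub_self, mul_zero, add_zero]

include hsep in
theorem cubeDist_clusterMove_le (hε : 0 < ε) {t : ℝ} (ht : t ≤ 1) {μ : ProbabilityMeasure Cube}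
    (hμ : (μ : Measure Cube).support.Finite) {z w : Cube} (hz : z ∈ L) (hw : w ∈ atoms μ)
    (h : cubeDist n ε z w < 1) : cubeDist n ε z (clusterMove n ε L t μ w) ≤ 2 := by
  have hpos : 0 < ∫ w, cutoff 1 (cubeDist n ε z w) ∂(μ : Measure Cube) :=
    (integral_pos_iff_exists_atom hμ fun w => cutoff_nonneg _ _).2
      ⟨w, hw, cutoff_pos_iff.2 (by linarith)⟩
  have hb := cubeDist_barycenter_le (n := n) (z := z) hε hμ (fun w => cutoff_nonneg _ _) hpos
    zero_le_two fun y _ hy => by have := cutoff_pos_iff.1 hy; linarith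
  have hw2 : cubeDist n ε z w ≤ 2 := by linarith
  rw [cubeDist_le_iff hε zero_le_two] at hb ⊢
  intro l hl
  have hwl := (cubeDist_le_iff hε zero_le_two).1 hw2 l hl
  rw [coe_clusterMove hsep hε ht μ hz hw2]
  have h0 : 0 ≤ max 0 (2 * t - 1) := le_max_left _ _
  have h1 : max 0 (2 * t - 1) ≤ 1 := max_le zero_le_one (by linarith)
  have hbl := abs_le.1 (hb l hl)
  have hwl := abs_le.1 hwl
  refine abs_le.2 ⟨?_, ?_⟩
  · nlinarith [hbl.1, hwl.1]
  · nlinarith [hbl.2, hwl.2]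

end
end

section
open Set Filter
universe v w

/-- Joint continuity of the cluster deformation in time and measure, on a set of measures for which
the clusters have positive mass. -/
theorem continuousOn_clusterDeformation {n : ℕ} {ε : ℝ} (hε : 0 < ε) {L : Finset Cube}
    (hsep : ∀ z ∈ L, ∀ z' ∈ L, z ≠ z' → 8 ≤ cubeDist n ε z z')
    {S : Set (ProbabilityMeasure Cube)} (hS : S ⊆ Pf Cube)
    (hpos : ∀ μ ∈ S, ∀ z ∈ L, 0 < ∫ w, cutoff 1 (cubeDist n ε z w) ∂(μ : Measure Cube)) :
    ContinuousOn (fun p : ℝ × ProbabilityMeasure Cube => clusterDeformation n ε L p.1 p.2)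
      (Icc 0 1 ×ˢ S) := by
  rw [continuousOn_iff_continuous_domRestrict]
  have hsnd : Continuous fun p : ↥(Icc (0 : ℝ) 1 ×ˢ S) => (p : ℝ × ProbabilityMeasure Cube).2 :=
    continuous_snd.comp continuous_subtype_val
  have hcd : ∀ k z, Continuous fun w => cutoff k (cubeDist n ε z w) := fun k z =>
    (continuous_cutoff k).comp (continuous_cubeDist z)
  have ht : Continuous fun p : ↥(Icc (0 : ℝ) 1 ×ˢ S) × Cube =>
      (p.1 : ℝ × ProbabilityMeasure Cube).1 := by fun_prop
  have hcoord : ∀ l, Continuous fun p : ↥(Icc (0 : ℝ) 1 ×ˢ S) × Cube => (p.2 l : ℝ) := fun l =>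
    continuous_subtype_val.comp ((continuous_apply l).comp continuous_snd)
  have ha : Continuous fun p : ↥(Icc (0 : ℝ) 1 ×ˢ S) × Cube =>
      clusterMass n ε L (p.1 : ℝ × ProbabilityMeasure Cube).1 p.2 := by
    unfold clusterMass
    refine continuous_const.sub (Continuous.mul (continuous_const.min (continuous_const.mul ht)) ?_)
    exact continuous_const.sub (continuous_finsetSum _ fun z _ => (hcd 1 z).comp continuous_snd)
  refine continuous_transport (Θ := ↥(Icc (0 : ℝ) 1 ×ˢ S)) hsnd
    (a := fun p => clusterMass n ε L p.1.1)
    (T := fun p => clusterMove n ε L p.1.1 p.1.2) (x := fun p => heavy p.1.2)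
    (fun p => finite_support (hS p.2.2)) (fun p => clusterMass_nonneg hsep hε p.2.1.1)
    (fun p => clusterMass_le_one hsep hε p.2.1.1) ?_ ha fun g hg => ha.mul (hg.comp ?_)
  · exact (continuousOn_heavy.mono hS).comp_continuous hsnd fun p => p.2.2
  · refine continuous_pi fun l => continuous_projIcc.comp ?_
    refine (hcoord l).add (Continuous.mul (continuous_const.max
      ((continuous_const.mul ht).sub continuous_const)) ?_)
    refine continuous_finsetSum _ fun z hz => ((hcd 2 z).comp continuous_snd).mul
      (Continuous.sub ?_ (hcoord l))
    have h := (continuousOn_barycenter (hcd 1 z)).comp_continuous hsnd fun p => hpos _ p.2.2 z hz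
    exact continuous_subtype_val.comp ((continuous_pi_iff.1 h l).comp continuous_fst)

section
variable {n : ℕ} {ε : ℝ} {L : Finset Cube}
  (hsep : ∀ z ∈ L, ∀ z' ∈ L, z ≠ z' → 8 ≤ cubeDist n ε z z')

include hsep in
/-- A measure whose heavy point lies outside of all clusters, with an atom in each cluster, has at
least one atom more than there are clusters; if it has no further atoms, then it has exactly one
atom in each cluster. -/
theorem atoms_of_clusters [DecidableEq Cube] (hε : 0 < ε) {μ : ProbabilityMeasure Cube}
    (hμ : μ ∈ Pf Cube)
    (hh : ∀ z ∈ L, 4 < cubeDist n ε z (heavy μ)) {w : Cube → Cube}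
    (hw : ∀ z ∈ L, w z ∈ atoms μ ∧ cubeDist n ε z (w z) < 3) :
    L.card + 1 ≤ (atoms μ).card ∧ InjOn w L ∧
      ((atoms μ).card ≤ L.card + 1 → L.image w = (atoms μ).erase (heavy μ)) := by
  have hinj : InjOn w L := by
    intro z hz z' hz' h
    by_contra hne
    have h1 := (hw z hz).2
    have h2 := (hw z' hz').2
    have h3 := four_lt_of_lt_four hsep hε hz hz' hne (by linarith : cubeDist n ε z (w z) < 4)
    rw [h] at h3
    linarith
  have hsub : L.image w ⊆ (atoms μ).erase (heavy μ) := by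
    intro y hy
    obtain ⟨z, hz, rfl⟩ := Finset.mem_image.1 hy
    refine Finset.mem_erase.2 ⟨fun h => ?_, (hw z hz).1⟩
    have h1 := (hw z hz).2
    have h2 := hh z hz
    rw [h] at h1
    linarith
  have hcard := Finset.card_le_card hsub
  have hpos := card_atoms_pos hμ
  rw [Finset.card_image_of_injOn hinj, Finset.card_erase_of_mem (heavy_mem_atoms hμ)] at hcard
  refine ⟨by omega, hinj, fun h => Finset.eq_of_subset_of_card_le hsub ?_⟩
  rw [Finset.card_image_of_injOn hinj, Finset.card_erase_of_mem (heavy_mem_atoms hμ)]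
  omega

end

/-! ### Induction on the number of atoms -/

theorem exists_continuous_extension {Y : Type u} [TopologicalSpace Y] [NormalSpace Y] {T : Type v}
    [TopologicalSpace T] [TietzeExtension.{u, v} T] {A : Set Y} (hA : IsClosed A) {f : Y → T}
    (hf : ContinuousOn f A) : ∃ g : Y → T, Continuous g ∧ EqOn g f A := by
  obtain ⟨g, hg⟩ := ContinuousMap.exists_restrict_eq hA ⟨A.domRestrict f, hf.domRestrict⟩
  exact ⟨g, g.continuous, fun y hy => DFunLike.congr_fun hg ⟨y, hy⟩⟩

theorem starMeasure_congr {X : Type v} [TopologicalSpace X] [MetrizableSpace X] [CompactSpace X]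
    [MeasurableSpace X] [BorelSpace X] {ι : Type w} {s : Finset ι} {m m' : ι → ℝ} {c c' : ι → X}
    {x : X} (hm0 : ∀ i ∈ s, 0 ≤ m i) (hs : ∑ i ∈ s, m i ≤ 1)
    (hm : ∀ i ∈ s, m i = m' i) (hc : ∀ i ∈ s, c i = c' i) :
    starMeasure s m c x = starMeasure s m' c' x := by
  have h2 : ∑ i ∈ s, m i = ∑ i ∈ s, m' i := Finset.sum_congr rfl hm
  refine eq_of_forall_integral_eq fun g _ => ?_
  rw [integral_starMeasure hm0 hs, integral_starMeasure (fun i hi => hm i hi ▸ hm0 i hi) (h2 ▸ hs),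
    h2]
  congr 1
  exact Finset.sum_congr rfl fun i hi => by rw [hm i hi, hc i hi]

/-- The measures with exactly one atom in each cluster, besides the heavy point, form an absolute
neighbourhood extensor: they are parametrized by the positions of their atoms and by their
masses, to which Tietze's theorem applies. -/
theorem isANE_clusterStratum {n : ℕ} {ε : ℝ} (hε : 0 < ε) {L : Finset Cube}
    (hsep : ∀ z ∈ L, ∀ z' ∈ L, z ≠ z' → 8 ≤ cubeDist n ε z z')
    {G : Set (ProbabilityMeasure Cube)} (hG : IsOpen G)
    (hGh : ∀ μ ∈ Pf Cube, μ ∈ G → ∀ z ∈ L, 4 < cubeDist n ε z (heavy μ))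
    (hGw : ∀ μ ∈ Pf Cube, μ ∈ G → ∀ z ∈ L, ∃ w ∈ atoms μ, cubeDist n ε z w < 3) :
    IsANE.{u} ({μ | μ ∈ Pf Cube ∧ (atoms μ).card ≤ L.card + 1} ∩ G) := by
  classical
  intro Y _ _ A hA f hf hfS
  let := metrizableSpaceMetric Y
  have hcd : ∀ k z, Continuous fun w => cutoff k (cubeDist n ε z w) := fun k z =>
    (continuous_cutoff k).comp (continuous_cubeDist z)
  have hstar : ∀ a ∈ A, ∃ w : Cube → Cube, InjOn w L ∧
      L.image w = (atoms (f a)).erase (heavy (f a)) ∧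
      (∀ z ∈ L, ∫ w, cutoff 3 (cubeDist n ε z w) ∂(f a : Measure Cube) =
        (f a : Measure Cube).real {w z}) ∧
      ∀ z ∈ L, 0 < ∫ w, cutoff 3 (cubeDist n ε z w) ∂(f a : Measure Cube) ∧
        barycenter (fun w => cutoff 3 (cubeDist n ε z w)) (f a) = w z := by
    intro a ha
    obtain ⟨⟨hP, hcard⟩, hfG⟩ := hfS ha
    have hfin := finite_support hP
    choose! w hwa hwd using hGw (f a) hP hfG
    obtain ⟨-, hinj, himg⟩ :=
      atoms_of_clusters hsep hε hP (hGh _ hP hfG) fun z hz => ⟨hwa z hz, hwd z hz⟩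
    have himg := himg hcard
    -- `w z` is the only atom in the cluster of `z`
    have huniq : ∀ z ∈ L, ∀ y ∈ atoms (f a), y ≠ w z → cutoff 3 (cubeDist n ε z y) = 0 := by
      intro z hz y hy hne
      refine cutoff_eq_zero ?_
      by_cases hyh : y = heavy (f a)
      · rw [hyh]; linarith [hGh _ hP hfG z hz]
      · have : y ∈ L.image w := by rw [himg]; exact Finset.mem_erase.2 ⟨hyh, hy⟩
        obtain ⟨z', hz', rfl⟩ := Finset.mem_image.1 this
        have hzz' : z' ≠ z := fun h => hne (by rw [h])
        have := four_lt_of_lt_four hsep hε hz' hz hzz' (by linarith [hwd z' hz'] :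
          cubeDist n ε z' (w z') < 4)
        linarith
    have hpos : ∀ z ∈ L, 0 < ∫ w, cutoff 3 (cubeDist n ε z w) ∂(f a : Measure Cube) :=
      fun z hz => (integral_pos_iff_exists_atom hfin fun w => cutoff_nonneg _ _).2
        ⟨w z, hwa z hz, cutoff_pos_iff.2 (by linarith [hwd z hz])⟩
    refine ⟨w, hinj, himg, fun z hz => ?_, fun z hz => ⟨hpos z hz, ?_⟩⟩
    · rw [integral_eq_sum (measure_compl_atoms hfin), Finset.sum_eq_single_of_mem _ (hwa z hz)
        fun y hy hne => by rw [huniq z hz y hy hne, mul_zero],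
        cutoff_eq_one (hwd z hz).le, mul_one]
    · exact barycenter_eq hfin (fun w => cutoff_nonneg _ _) (hpos z hz) fun y hy hy0 =>
        by_contra fun hne => hy0.ne' (huniq z hz y hy hne)
  obtain ⟨x, hx, hxf⟩ := exists_continuous_extension hA (f := fun y => heavy (f y))
    (continuousOn_heavy.comp hf fun a ha => (hfS ha).1.1)
  have hm : ∀ z, ∃ m : Y → ℝ, Continuous m ∧
      EqOn m (fun y => ∫ w, cutoff 3 (cubeDist n ε z w) ∂(f y : Measure Cube)) A := fun z =>
    exists_continuous_extension hA ((continuous_integral (hcd 3 z)).comp_continuousOn hf)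
  choose m hm hmf using hm
  have hc : ∀ z, ∃ c : Y → Cube, z ∈ L → Continuous c ∧
      EqOn c (fun y => barycenter (fun w => cutoff 3 (cubeDist n ε z w)) (f y)) A := fun z => by
    by_cases hz : z ∈ L
    · obtain ⟨c, h1, h2⟩ := exists_continuous_extension hA
        ((continuousOn_barycenter (hcd 3 z)).comp hf fun a ha => by
          obtain ⟨w, -, -, -, h⟩ := hstar a ha
          exact (h z hz).1)
      exact ⟨c, fun _ => ⟨h1, h2⟩⟩
    · exact ⟨fun _ => z, fun h => (hz h).elim⟩
  choose c hc using hc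
  -- The extended masses have to be made nonnegative, with a total of at most `β`.
  set β : ℝ := 1 / (L.card + 2) with hβ
  have hβ0 : 0 < β := by positivity
  have hβ1 : β ≤ 1 :=
    (div_le_one (by positivity)).2 (by linarith [(L.card.cast_nonneg : (0 : ℝ) ≤ L.card)])
  set σ : Y → ℝ := fun y => ∑ z ∈ L, max 0 (m z y) with hσ
  have hσc : Continuous σ := continuous_finsetSum _ fun z _ => continuous_const.max (hm z)
  have hσ0 : ∀ y, 0 ≤ σ y := fun y => Finset.sum_nonneg fun z _ => le_max_left _ _
  have hmax : ∀ y, 0 < max β (σ y) := fun y => lt_max_of_lt_left hβ0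
  set m' : Y → Cube → ℝ := fun y z => max 0 (m z y) * (β / max β (σ y)) with hm'
  have hm'0 : ∀ y, ∀ z ∈ L, 0 ≤ m' y z := fun y z _ =>
    mul_nonneg (le_max_left _ _) (div_nonneg hβ0.le (hmax y).le)
  have hm's : ∀ y, ∑ z ∈ L, m' y z ≤ β := fun y => by
    rw [hm', ← Finset.sum_mul, mul_div_assoc', div_le_iff₀ (hmax y), mul_comm]
    exact mul_le_mul_of_nonneg_left (le_max_right _ _) hβ0.le
  set F : Y → ProbabilityMeasure Cube := fun y => starMeasure L (m' y) (fun z => c z y) (x y)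
    with hF
  have hFc : Continuous F := by
    refine continuous_starMeasure hm'0 (fun y => (hm's y).trans hβ1) (fun z _ => ?_)
      (fun z hz => (hc z hz).1) hx
    exact (continuous_const.max (hm z)).mul
      (continuous_const.div (continuous_const.max hσc) fun y => (hmax y).ne')
  have hFf : EqOn F f A := by
    intro a ha
    obtain ⟨w, hinj, himg, hmass, hbar⟩ := hstar a ha
    obtain ⟨⟨hP, hcard⟩, -⟩ := hfS ha
    have h1 : ∀ z ∈ L, max 0 (m z a) = (f a : Measure Cube).real {w z} := fun z hz => by
      rw [hmf z ha]
      dsimp only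
      rw [hmass z hz, max_eq_right measureReal_nonneg]
    have h2 : σ a ≤ β := by
      have h3 := sum_real_eq_one (measure_compl_atoms (finite_support hP))
      rw [← Finset.add_sum_erase _ _ (heavy_mem_atoms hP), ← himg, Finset.sum_image hinj] at h3
      have h4 : σ a = ∑ z ∈ L, (f a : Measure Cube).real {w z} := Finset.sum_congr rfl h1
      have h5 := one_sub_le_real_heavy hP
      have h6 : (1 : ℝ) / ((atoms (f a)).card + 1) = β := by
        have : (atoms (f a)).card = L.card + 1 := by
          have h7 := congrArg Finset.card himg
          rw [Finset.card_image_of_injOn hinj, Finset.card_erase_of_mem (heavy_mem_atoms hP)] at h7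
          have := card_atoms_pos hP
          omega
        rw [this, hβ]
        push_cast
        ring
      rw [h6] at h5
      linarith
    change starMeasure L (m' a) (fun z => c z a) (x a) = f a
    conv_rhs => rw [← eq_starMeasure hP hinj himg]
    rw [hxf ha]
    refine starMeasure_congr (hm'0 a) ((hm's a).trans hβ1) (fun z hz => ?_) fun z hz => ?_
    · rw [hm']
      dsimp only
      rw [h1 z hz, max_eq_left h2, div_self hβ0.ne', mul_one]
    · rw [(hc z hz).2 ha]
      exact (hbar z hz).2
  refine HasNhdExtension.inter ⟨univ, isOpen_univ, subset_univ _, F, hFc.continuousOn,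
    fun y _ => ?_, hFf⟩ hG fun a ha => (hfS ha).2
  exact starMeasure_mem (c := fun z => c z y) (x := x y) (hm'0 y) le_rfl (hm's y)

theorem isClosed_card_atoms_le (k : ℕ) :
    IsClosed {μ : ProbabilityMeasure Cube | μ ∈ Pf Cube ∧ (atoms μ).card ≤ k} :=
  (isCompact_card_atoms_le k).isClosed

/-- Induction step on the number of atoms: from measures with more than `k` atoms to measures with
at least `k` atoms, within a class `P` of measures that contains all measures with at most as many
atoms as some member. -/
theorem isANE_le_card_atoms_of_succ {P : Set (ProbabilityMeasure Cube)} (hP : P ⊆ Pf Cube)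
    (hPlow : ∀ μ ∈ P, ∀ ν ∈ Pf Cube, (atoms ν).card ≤ (atoms μ).card → ν ∈ P) {k : ℕ}
    (hsucc : IsANE.{u} (P ∩ {μ | k + 1 ≤ (atoms μ).card})) :
    IsANE.{u} (P ∩ {μ | k ≤ (atoms μ).card}) := by
  classical
  refine IsANE.of_locally fun μ₀ hμ₀ => ?_
  obtain ⟨hμ₀P, hμ₀k⟩ := hμ₀
  have hμ₀f := hP hμ₀P
  set C : Set (ProbabilityMeasure Cube) := {μ | μ ∈ Pf Cube ∧ (atoms μ).card ≤ k} with hC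
  have hCc : IsClosed C := isClosed_card_atoms_le k
  have hPC : (P ∩ {μ | k ≤ (atoms μ).card}) \ C = P ∩ {μ | k + 1 ≤ (atoms μ).card} := by
    ext μ
    constructor
    · rintro ⟨⟨h1, -⟩, h3⟩
      exact ⟨h1, not_le.1 fun h => h3 ⟨hP h1, h⟩⟩
    · rintro ⟨h1, h2 : k + 1 ≤ _⟩
      exact ⟨⟨h1, (Nat.le_succ k).trans h2⟩, fun h => absurd h.2 (not_le.2 h2)⟩
  rcases (show k ≤ (atoms μ₀).card from hμ₀k).lt_or_eq with hlt | heq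
  · refine ⟨Cᶜ, hCc.isOpen_compl, fun h => absurd h.2 (not_le.2 hlt), ?_⟩
    rwa [← sdiff_eq, hPC]
  set L := (atoms μ₀).erase (heavy μ₀) with hL
  have hLk : L.card + 1 = k := by
    rw [hL, Finset.card_erase_of_mem (heavy_mem_atoms hμ₀f), heq]
    have := card_atoms_pos hμ₀f
    omega
  obtain ⟨n, ε, hε, hsep'⟩ := exists_cubeDist_ge (atoms μ₀) 8
  have hsep : ∀ z ∈ L, ∀ z' ∈ L, z ≠ z' → 8 ≤ cubeDist n ε z z' := fun z hz z' hz' =>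
    hsep' z (Finset.mem_of_mem_erase hz) z' (Finset.mem_of_mem_erase hz')
  have hcd : ∀ k z, Continuous fun w => cutoff k (cubeDist n ε z w) := fun k z =>
    (continuous_cutoff k).comp (continuous_cubeDist z)
  have hVo : IsOpen {x | ∀ z ∈ L, 4 < cubeDist n ε z x} := by
    have : {x | ∀ z ∈ L, 4 < cubeDist n ε z x} = ⋂ z ∈ L, {x | 4 < cubeDist n ε z x} := by
      ext; simp
    rw [this]
    exact isOpen_biInter_finset fun z _ => isOpen_lt continuous_const (continuous_cubeDist z)
  obtain ⟨Gh, hGh, hGhV⟩ := continuousOn_iff'.1 (continuousOn_heavy (X := Cube)) _ hVo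
  have hGh' : ∀ μ ∈ Pf Cube, μ ∈ Gh ↔ ∀ z ∈ L, 4 < cubeDist n ε z (heavy μ) := fun μ hμ => by
    have := congrArg (μ ∈ ·) hGhV
    simpa [hμ] using this.symm
  set W : ℝ → Set (ProbabilityMeasure Cube) := fun k =>
    ⋂ z ∈ L, {μ | 0 < ∫ w, cutoff k (cubeDist n ε z w) ∂(μ : Measure Cube)} with hW
  have hWo : ∀ k, IsOpen (W k) := fun k => isOpen_biInter_finset fun z _ =>
    isOpen_lt continuous_const (continuous_integral (hcd k z))
  have hWmem : ∀ k, ∀ μ ∈ Pf Cube, μ ∈ W k ↔ ∀ z ∈ L, ∃ w ∈ atoms μ, cubeDist n ε z w < k + 1 := by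
    intro k μ hμ
    simp only [hW, mem_iInter, mem_ofPred_eq]
    refine forall₂_congr fun z _ => ?_
    rw [integral_pos_iff_exists_atom (finite_support hμ) fun w => cutoff_nonneg _ _]
    simp only [cutoff_pos_iff]
  have hG2 : ∀ μ ∈ Pf Cube, μ ∈ W 2 → ∀ z ∈ L, ∃ w ∈ atoms μ, cubeDist n ε z w < 3 :=
    fun μ hμ h z hz => by
      obtain ⟨w, hw, hzw⟩ := (hWmem 2 μ hμ).1 h z hz
      exact ⟨w, hw, by linarith⟩
  have hG0 : ∀ μ ∈ Pf Cube, μ ∈ W 0 → ∀ z ∈ L, ∃ w ∈ atoms μ, cubeDist n ε z w < 1 :=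
    fun μ hμ h z hz => by
      obtain ⟨w, hw, hzw⟩ := (hWmem 0 μ hμ).1 h z hz
      exact ⟨w, hw, by linarith⟩
  -- every measure in `Pf Cube ∩ Gh ∩ W 2` has at least `k` atoms
  have hk : ∀ μ ∈ Pf Cube, μ ∈ Gh → μ ∈ W 2 → k ≤ (atoms μ).card := by
    intro μ hμ h1 h2
    choose! w hwa hwd using hG2 μ hμ h2
    have := (atoms_of_clusters hsep hε hμ ((hGh' μ hμ).1 h1) fun z hz => ⟨hwa z hz, hwd z hz⟩).1
    omega
  -- A measure in `W 0` has an atom at distance less than `1` from each point of `L`; these atoms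
  -- are moved to distance at most `2`, so the deformation of `W 0` stays in `W 2`.
  set Z := P ∩ {μ | k ≤ (atoms μ).card} ∩ (Gh ∩ W 2) with hZ
  have hW02 : ∀ μ ∈ Pf Cube, μ ∈ W 0 → μ ∈ W 2 := fun μ hμ h => (hWmem 2 μ hμ).2 fun z hz => by
    obtain ⟨w, hw, hzw⟩ := hG0 μ hμ h z hz
    exact ⟨w, hw, by linarith⟩
  have hZmem : ∀ μ ∈ Z ∩ (Gh ∩ W 0), μ ∈ Pf Cube ∧ (∀ z ∈ L, 4 < cubeDist n ε z (heavy μ)) ∧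
      ∀ z ∈ L, ∃ w ∈ atoms μ, cubeDist n ε z w < 1 := fun μ hμ =>
    ⟨hP hμ.1.1.1, (hGh' μ (hP hμ.1.1.1)).1 hμ.2.1, hG0 μ (hP hμ.1.1.1) hμ.2.2⟩
  have hmain : IsANE.{u} (Z ∩ (Gh ∩ W 0)) := by
    refine IsANE.of_deformation (C := C) (h := clusterDeformation n ε L) hCc
      (hGh.inter (hWo 0)) ?_ ?_ ?_ ?_ ?_ ?_ ?_
    · have : Z ∩ C = {μ | μ ∈ Pf Cube ∧ (atoms μ).card ≤ L.card + 1} ∩ (Gh ∩ W 2) := by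
        rw [hLk]
        ext μ
        constructor
        · rintro ⟨⟨-, h1⟩, h2⟩
          exact ⟨h2, h1⟩
        · rintro ⟨h1, h2⟩
          exact ⟨⟨⟨hPlow μ₀ hμ₀P μ h1.1 (h1.2.trans hμ₀k), hk μ h1.1 h2.1 h2.2⟩, h2⟩, h1⟩
      rw [this]
      exact isANE_clusterStratum hε hsep (hGh.inter (hWo 2))
        (fun μ hμ h => (hGh' μ hμ).1 h.1) fun μ hμ h => hG2 μ hμ h.2
    · have : Z \ C = P ∩ {μ | k + 1 ≤ (atoms μ).card} ∩ (Gh ∩ W 2) := by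
        rw [← hPC, hZ]
        ext μ
        exact ⟨fun h => ⟨⟨h.1.1, h.2⟩, h.1.2⟩, fun h => ⟨⟨h.1.1, h.2⟩, h.1.2⟩⟩
      rw [this]
      exact hsucc.inter_isOpen (hGh.inter (hWo 2))
    · refine continuousOn_clusterDeformation hε hsep (fun μ hμ => (hZmem μ hμ).1)
        fun μ hμ z hz => ?_
      obtain ⟨h1, -, h3⟩ := hZmem μ hμ
      obtain ⟨w, hw, hzw⟩ := h3 z hz
      exact (integral_pos_iff_exists_atom (finite_support h1) fun w => cutoff_nonneg _ _).2
        ⟨w, hw, cutoff_pos_iff.2 (by linarith)⟩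
    · intro μ hμ
      exact transport_eq_self (finite_support (hZmem μ hμ).1)
        (clusterMass_nonneg hsep hε le_rfl) (clusterMass_le_one hsep hε le_rfl)
        fun w _ => ⟨Or.inl (clusterMass_zero w), clusterMove_zero μ w⟩
    · intro μ hμ
      obtain ⟨h1, h2, -⟩ := hZmem μ hμ
      have hmem := transport_mem (a := clusterMass n ε L 1) (T := clusterMove n ε L 1 μ) h1
        (clusterMass_nonneg hsep hε zero_le_one) (clusterMass_le_one hsep hε zero_le_one)
        (clusterMove_of_far μ fun z hz => (h2 z hz).le)
      refine ⟨hmem.1, ?_⟩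
      have hF := measure_compl_transport (a := clusterMass n ε L 1) (T := clusterMove n ε L 1 μ)
        (x := heavy μ) (finite_support h1) (clusterMass_nonneg hsep hε zero_le_one)
        (clusterMass_le_one hsep hε zero_le_one)
        (F := insert (heavy μ) (L.image fun z =>
          barycenter (fun w => cutoff 1 (cubeDist n ε z w)) μ))
        (Finset.mem_insert_self _ _) fun w _ hw => by
          rw [clusterMass_one] at hw
          obtain ⟨z, hz, hzw⟩ := Finset.exists_lt_of_sum_lt (s := L) (f := fun _ => (0 : ℝ))
            (by simpa using hw)
          have hzw := cutoff_pos_iff.1 hzw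
          rw [clusterMove_one hsep hε μ hz (by linarith)]
          exact Finset.mem_insert_of_mem (Finset.mem_image_of_mem _ hz)
      refine (Finset.card_le_card (atoms_subset hF)).trans ((Finset.card_insert_le _ _).trans ?_)
      have := Finset.card_image_le (s := L)
        (f := fun z => barycenter (fun w => cutoff 1 (cubeDist n ε z w)) μ)
      omega
    · intro t ht μ hμ
      obtain ⟨h1, h2, h3⟩ := hZmem μ hμ
      obtain ⟨hm1, hm2, hm3⟩ := transport_mem (a := clusterMass n ε L t)
        (T := clusterMove n ε L t μ) h1
        (clusterMass_nonneg hsep hε ht.1) (clusterMass_le_one hsep hε ht.1)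
        (clusterMove_of_far μ fun z hz => (h2 z hz).le)
      have hm4 : clusterDeformation n ε L t μ ∈ Gh :=
        (hGh' _ hm1).2 fun z hz => by rw [hm3]; exact h2 z hz
      have hm5 : clusterDeformation n ε L t μ ∈ W 2 := (hWmem 2 _ hm1).2 fun z hz => by
        obtain ⟨w, hw, hzw⟩ := h3 z hz
        refine ⟨clusterMove n ε L t μ w, mem_atoms_transport (finite_support h1)
          (clusterMass_nonneg hsep hε ht.1) (clusterMass_le_one hsep hε ht.1) hw ?_, ?_⟩
        · rw [clusterMass_eq_one hsep hε hz hzw.le]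
          exact one_pos
        · have := cubeDist_clusterMove_le hsep hε ht.2 (finite_support h1) hz hw hzw
          linarith
      exact ⟨⟨hPlow μ hμ.1.1.1 _ hm1 hm2, hk _ hm1 hm4 hm5⟩, hm4, hm5⟩
    · intro t ht μ hμ hμC
      obtain ⟨h1, h2, h3⟩ := hZmem μ hμ
      choose! w hwa hwd using h3
      have himg := (atoms_of_clusters hsep hε h1 h2 fun z hz =>
        ⟨hwa z hz, by linarith [hwd z hz]⟩).2.2 (by rw [hLk]; exact hμC.2)
      refine transport_eq_self (finite_support h1) (clusterMass_nonneg hsep hε ht.1)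
        (clusterMass_le_one hsep hε ht.1) fun y hy => ?_
      by_cases hyh : y = heavy μ
      · subst hyh
        exact ⟨Or.inr rfl, clusterMove_of_far μ fun z hz => (h2 z hz).le⟩
      have hy' : y ∈ L.image w := by rw [himg]; exact Finset.mem_erase.2 ⟨hyh, hy⟩
      obtain ⟨z, hz, rfl⟩ := Finset.mem_image.1 hy'
      refine ⟨Or.inl (clusterMass_eq_one hsep hε hz (hwd z hz).le),
        clusterMove_of_eq hsep hε ht.2 hz (by linarith [hwd z hz]) ?_⟩
      refine barycenter_eq (finite_support h1) (fun w => cutoff_nonneg _ _)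
        ((integral_pos_iff_exists_atom (finite_support h1) fun w => cutoff_nonneg _ _).2
          ⟨w z, hy, cutoff_pos_iff.2 (by linarith [hwd z hz])⟩) fun y hy hyz => ?_
      have hyz := cutoff_pos_iff.1 hyz
      have hyh : y ≠ heavy μ := fun h => by
        rw [h] at hyz
        linarith [h2 z hz]
      have hy' : y ∈ L.image w := by rw [himg]; exact Finset.mem_erase.2 ⟨hyh, hy⟩
      obtain ⟨z', hz', rfl⟩ := Finset.mem_image.1 hy'
      by_contra hne
      have := four_lt_of_lt_four hsep hε hz' hz (fun h => hne (by rw [h]))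
        (by linarith [hwd z' hz'])
      linarith
  refine ⟨Gh ∩ W 0, hGh.inter (hWo 0), ⟨?_, ?_⟩, ?_⟩
  · refine (hGh' μ₀ hμ₀f).2 fun z hz => ?_
    have := hsep' z (Finset.mem_of_mem_erase hz) _ (heavy_mem_atoms hμ₀f)
      (Finset.ne_of_mem_erase hz)
    linarith
  · refine (hWmem 0 μ₀ hμ₀f).2 fun z hz => ⟨z, Finset.mem_of_mem_erase hz, ?_⟩
    rw [cubeDist_self]
    norm_num
  · have : P ∩ {μ | k ≤ (atoms μ).card} ∩ (Gh ∩ W 0) = Z ∩ (Gh ∩ W 0) := by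
      ext μ
      constructor
      · rintro ⟨h1, h2⟩
        exact ⟨⟨h1, h2.1, hW02 μ (hP h1.1) h2.2⟩, h2⟩
      · rintro ⟨h1, h2⟩
        exact ⟨h1.1, h2⟩
    rwa [this]

theorem isANE_Pf_cube : IsANE.{u} (Pf Cube) := by
  classical
  -- the measures with at most `N` atoms: downward induction on the least number of atoms
  have h1 : ∀ N j k : ℕ, N + 1 ≤ k + j →
      IsANE.{u} ({μ : ProbabilityMeasure Cube | μ ∈ Pf Cube ∧ (atoms μ).card ≤ N} ∩
        {μ | k ≤ (atoms μ).card}) := by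
    intro N j
    induction j with
    | zero =>
      intro k hk
      have : {μ : ProbabilityMeasure Cube | μ ∈ Pf Cube ∧ (atoms μ).card ≤ N} ∩
          {μ | k ≤ (atoms μ).card} = ∅ := by
        refine eq_empty_of_forall_notMem ?_
        rintro μ ⟨⟨-, h2⟩, h3 : k ≤ _⟩
        omega
      rw [this]
      exact isANE_empty
    | succ j ih =>
      intro k hk
      exact isANE_le_card_atoms_of_succ
        (P := {μ | μ ∈ Pf Cube ∧ (atoms μ).card ≤ N}) (fun μ hμ => hμ.1)
        (fun μ hμ ν hν h => ⟨hν, h.trans hμ.2⟩) (ih (k + 1) (by omega))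
  -- away from the Dirac measures the number of atoms is locally bounded
  have h2 : IsANE.{u} (Pf Cube ∩ {μ | 1 + 1 ≤ (atoms μ).card}) := by
    refine IsANE.of_locally fun μ hμ => ?_
    obtain ⟨hμ, hμ2⟩ := hμ
    have hcard : 0 < ((atoms μ).erase (heavy μ)).card := by
      rw [Finset.card_erase_of_mem (heavy_mem_atoms hμ)]
      exact Nat.sub_pos_of_lt hμ2
    obtain ⟨y, hy⟩ := Finset.card_pos.1 hcard
    obtain ⟨hyh, hy⟩ := Finset.mem_erase.1 hy
    obtain ⟨U, V, hU, hV, hhU, hyV, hUV⟩ := t2_separation hyh.symm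
    obtain ⟨g, hg0, hg1, hg01⟩ := exists_continuous_zero_one_of_isClosed hV.isClosed_compl
      (isClosed_singleton (x := y)) (by simpa using hyV)
    have hc : 0 < ∫ z, g z ∂(μ : Measure Cube) :=
      (integral_pos_iff_exists_atom (finite_support hμ) fun z => (hg01 z).1).2
        ⟨y, hy, by rw [hg1 rfl]; exact one_pos⟩
    set c := (∫ z, g z ∂(μ : Measure Cube)) / 2 with hcdef
    obtain ⟨N, hN⟩ := exists_nat_gt (1 / c)
    obtain ⟨Gh, hGh, hGhU⟩ := continuousOn_iff'.1 (continuousOn_heavy (X := Cube)) _ hU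
    have hGh' : ∀ ν ∈ Pf Cube, ν ∈ Gh ↔ heavy ν ∈ U := fun ν hν => by
      have := congrArg (ν ∈ ·) hGhU
      simpa [hν] using this.symm
    have hGo : IsOpen (Gh ∩ {ν : ProbabilityMeasure Cube | c < ∫ z, g z ∂(ν : Measure Cube)}) :=
      hGh.inter (isOpen_lt continuous_const (continuous_integral g.continuous))
    refine ⟨_, hGo, ⟨(hGh' μ hμ).2 hhU, half_lt_self hc⟩, ?_⟩
    have hN' : ∀ ν ∈ Pf Cube, ν ∈ Gh → c < ∫ z, g z ∂(ν : Measure Cube) →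
        (atoms ν).card ≤ N := by
      intro ν hν hνG hνc
      have hcompl := measure_compl_atoms (finite_support hν)
      have h4 := sum_real_eq_one hcompl
      have h5 := one_sub_le_real_heavy hν
      have h6 : g (heavy ν) = 0 := hg0 (hUV.notMem_of_mem_left ((hGh' ν hν).1 hνG))
      rw [integral_eq_sum hcompl] at hνc
      rw [← Finset.add_sum_erase _ _ (heavy_mem_atoms hν)] at h4 hνc
      rw [h6, mul_zero, zero_add] at hνc
      have h7 : ∑ z ∈ (atoms ν).erase (heavy ν), (ν : Measure Cube).real {z} * g z ≤
          ∑ z ∈ (atoms ν).erase (heavy ν), (ν : Measure Cube).real {z} :=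
        Finset.sum_le_sum fun z _ => mul_le_of_le_one_right measureReal_nonneg (hg01 z).2
      have h8 : c < 1 / ((atoms ν).card + 1) := by linarith
      rw [lt_one_div (half_pos hc) (by positivity)] at h8
      have h9 : ((atoms ν).card : ℝ) + 1 < N := h8.trans hN
      have h10 : (atoms ν).card + 1 < N := by exact_mod_cast h9
      omega
    have : Pf Cube ∩ {μ | 1 + 1 ≤ (atoms μ).card} ∩
          (Gh ∩ {ν : ProbabilityMeasure Cube | c < ∫ z, g z ∂(ν : Measure Cube)}) =
        {μ | μ ∈ Pf Cube ∧ (atoms μ).card ≤ N} ∩ {μ | 1 + 1 ≤ (atoms μ).card} ∩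
          (Gh ∩ {ν : ProbabilityMeasure Cube | c < ∫ z, g z ∂(ν : Measure Cube)}) := by
      ext ν
      exact ⟨fun h => ⟨⟨⟨h.1.1, hN' ν h.1.1 h.2.1 h.2.2⟩, h.1.2⟩, h.2⟩,
        fun h => ⟨⟨h.1.1.1, h.1.2⟩, h.2⟩⟩
    rw [this]
    exact (h1 N N 2 (by omega)).inter_isOpen hGo
  have h3 := isANE_le_card_atoms_of_succ Subset.rfl (fun μ _ ν hν _ => hν) h2
  have h4 : Pf Cube ∩ {μ | 1 ≤ (atoms μ).card} = Pf Cube :=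
    inter_eq_self_of_subset_left fun μ hμ => card_atoms_pos hμ
  rwa [h4] at h3
end

section
open Set Filter

/-! ### From the Hilbert cube to compact absolute neighbourhood retracts -/

theorem IsRetract.isNeighborhoodRetract {Y : Type u} [TopologicalSpace Y] {A : Set Y}
    (h : IsRetract A) : IsNeighborhoodRetract A := by
  obtain ⟨r, hr⟩ := h
  exact ⟨univ, isOpen_univ, subset_univ A, r.comp ⟨Subtype.val, continuous_subtype_val⟩, hr⟩

/-- A compact absolute neighbourhood retract embeds into the Hilbert cube as a neighbourhood
retract. -/
theorem IsANR.exists_retraction_cube {X : Type u} [TopologicalSpace X] [CompactSpace X] [Nonempty X]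
    (hX : IsANR X) : ∃ (i : X → Cube) (U : Set Cube) (R : Cube → X), Continuous i ∧ IsOpen U ∧
      range i ⊆ U ∧ ContinuousOn R U ∧ ∀ x, R (i x) = x := by
  classical
  have := hX.1
  let := metrizableSpaceMetric X
  obtain ⟨i, hi⟩ := Metric.PiNatEmbed.exists_embedding_to_hilbert_cube (X := X)
  have he : IsClosedEmbedding (fun x => ULift.up.{u} (i x)) :=
    Continuous.isClosedEmbedding (continuous_uliftUp.comp hi.continuous)
      fun x y h => hi.injective (congrArg ULift.down h)
  have : MetrizableSpace (ULift.{u} Cube) := IsEmbedding.uliftDown.metrizableSpace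
  obtain ⟨U, hU, hsub, r, hr⟩ := hX.2 (ULift.{u} Cube) _ he
  let φ := he.isEmbedding.toHomeomorph
  let R : Cube → X := fun c => if h : ULift.up c ∈ U then φ.symm (r ⟨ULift.up c, h⟩)
    else Classical.arbitrary X
  have hR : ∀ c (h : ULift.up c ∈ U), R c = φ.symm (r ⟨ULift.up c, h⟩) := fun c h => dif_pos h
  refine ⟨i, ULift.up ⁻¹' U, R, hi.continuous, hU.preimage continuous_uliftUp, ?_, ?_, ?_⟩
  · rintro _ ⟨x, rfl⟩
    exact hsub ⟨x, rfl⟩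
  · rw [continuousOn_iff_continuous_domRestrict]
    have : (ULift.up.{u} ⁻¹' U).domRestrict R =
        fun c => φ.symm (r ⟨ULift.up c.1, c.2⟩) := funext fun c => hR c.1 c.2
    rw [this]
    refine φ.symm.continuous.comp (r.continuous.comp ?_)
    exact (continuous_uliftUp.comp continuous_subtype_val).subtype_mk _
  · intro x
    rw [hR (i x) (hsub ⟨x, rfl⟩), hr ⟨_, x, rfl⟩]
    exact φ.symm_apply_apply x

theorem isANR_Pf {X : Type u} [TopologicalSpace X] [MeasurableSpace X] [BorelSpace X]
    [CompactSpace X] [Nonempty X] (hX : IsANR X) : IsANR (Pf X) := by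
  classical
  have := hX.1
  refine ⟨inferInstance, fun Y _ _ e he => ?_⟩
  obtain ⟨i, U, R, hi, hU, hiU, hR, hRi⟩ := hX.exists_retraction_cube
  -- measures on `X`, as measures on the cube
  set I : ProbabilityMeasure X → ProbabilityMeasure Cube := fun μ =>
    transport (fun _ => 1) i (i (heavy μ)) μ with hI
  have hImem : ∀ μ ∈ Pf X, I μ ∈ Pf Cube ∧ heavy (I μ) = i (heavy μ) := fun μ hμ => by
    have := transport_mem (a := fun _ => (1 : ℝ)) (T := i) hμ (fun _ => zero_le_one)
      (fun _ => le_rfl) rfl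
    exact ⟨this.1, this.2.2⟩
  have hIc : Continuous fun μ : Pf X => I μ := by
    refine continuous_transport (Θ := Pf X) (a := fun _ _ => 1) (T := fun _ => i)
      (x := fun μ => i (heavy (μ : ProbabilityMeasure X))) continuous_subtype_val
      (fun μ => finite_support μ.2) (fun _ _ => zero_le_one) (fun _ _ => le_rfl) ?_
      continuous_const fun g hg => ?_
    · exact hi.comp (continuousOn_heavy.comp_continuous continuous_subtype_val fun μ => μ.2)
    · exact continuous_const.mul (hg.comp (hi.comp continuous_snd))
  -- extend the inclusion of the closed subspace `Pf X` of `Y` to a neighbourhood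
  let φ := he.isEmbedding.toHomeomorph
  let f : Y → ProbabilityMeasure Cube := fun y =>
    if h : y ∈ range e then I (φ.symm ⟨y, h⟩)
    else ⟨Measure.dirac 0, Measure.dirac.isProbabilityMeasure⟩
  have hfe : ∀ y : range e, f y = I (φ.symm y) := fun y => dif_pos y.2
  obtain ⟨W, hW, hAW, F, hF, hFP, hFf⟩ := isANE_Pf_cube Y (range e) he.isClosed_range f
    (by
      rw [continuousOn_iff_continuous_domRestrict]
      have : (range e).domRestrict f = fun y => I (φ.symm y) := funext hfe
      rw [this]
      exact hIc.comp φ.symm.continuous)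
    fun y hy => by
      rw [hfe ⟨y, hy⟩]
      exact (hImem _ (φ.symm ⟨y, hy⟩).2).1
  have hFe : ∀ μ : Pf X, F (e μ) = I μ := fun μ => by
    rw [hFf ⟨μ, rfl⟩, hfe ⟨e μ, μ, rfl⟩]
    exact congrArg (fun ν : Pf X => I ν) (φ.symm_apply_apply μ)
  -- cut off the mass far from `X` and retract the rest
  have hic : IsClosed (range i) := (isCompact_range hi).isClosed
  obtain ⟨V, hV, hiV, hVU⟩ := normal_exists_closure_subset hic hU hiU
  obtain ⟨a, ha0, ha1, ha01⟩ := exists_continuous_zero_one_of_isClosed hV.isClosed_compl hic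
    (disjoint_compl_left_iff_subset.2 hiV)
  have haR : ∀ g : X → ℝ, Continuous g → Continuous fun c => a c * g (R c) := by
    intro g hg
    refine continuous_iff_continuousAt.2 fun c => ?_
    by_cases hc : c ∈ U
    · exact a.continuous.continuousAt.mul
        (hg.continuousAt.comp (hR.continuousAt (hU.mem_nhds hc)))
    · refine (continuousAt_const (y := (0 : ℝ))).congr ?_
      filter_upwards [isClosed_closure.isOpen_compl.mem_nhds fun h => hc (hVU h)] with c' hc'
      have h0 : a c' = 0 := ha0 fun h => hc' (subset_closure h)
      rw [h0, zero_mul]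
  set ρ : ProbabilityMeasure Cube → ProbabilityMeasure X := fun ν =>
    transport a R (R (heavy ν)) ν with hρ
  have hρmem : ∀ ν ∈ Pf Cube, ρ ν ∈ Pf X := fun ν hν =>
    (transport_mem hν (fun c => (ha01 c).1) (fun c => (ha01 c).2) rfl).1
  have hρI : ∀ μ ∈ Pf X, ρ (I μ) = μ := by
    intro μ hμ
    refine eq_of_forall_integral_eq fun g _ => ?_
    rw [hρ, integral_transport (finite_support (hImem μ hμ).1) (fun c => (ha01 c).1)
      (fun c => (ha01 c).2), hI, integral_transport (finite_support hμ) (fun _ => zero_le_one)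
      fun _ => le_rfl]
    have h1 : ∀ x, a (i x) = 1 := fun x => ha1 ⟨x, rfl⟩
    simp [h1, hRi]
  obtain ⟨Gh, hGh, hGhU⟩ := continuousOn_iff'.1 (continuousOn_heavy (X := Cube)) _ hU
  have hGh' : ∀ ν ∈ Pf Cube, ν ∈ Gh ↔ heavy ν ∈ U := fun ν hν => by
    have := congrArg (ν ∈ ·) hGhU
    simpa [hν] using this.symm
  have hWGh : range e ⊆ W ∩ F ⁻¹' Gh := by
    rintro _ ⟨μ, rfl⟩
    refine ⟨hAW ⟨μ, rfl⟩, ?_⟩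
    have h1 := hImem μ μ.2
    rw [mem_preimage, hFe, hGh' _ h1.1, h1.2]
    exact hiU ⟨_, rfl⟩
  have hFc : Continuous fun y : ↥(W ∩ F ⁻¹' Gh) => F y :=
    (hF.mono inter_subset_left).domRestrict
  have hρc : Continuous fun y : ↥(W ∩ F ⁻¹' Gh) => ρ (F y) := by
    have hFy : ∀ y : ↥(W ∩ F ⁻¹' Gh), F y ∈ Pf Cube := fun y => hFP y.2.1
    refine continuous_transport (Θ := ↥(W ∩ F ⁻¹' Gh)) (a := fun _ => a) (T := fun _ => R)
      (x := fun y => R (heavy (F y))) hFc (fun y => finite_support (hFy y))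
      (fun _ c => (ha01 c).1) (fun _ c => (ha01 c).2) ?_ (a.continuous.comp continuous_snd)
      fun g hg => (haR g hg).comp continuous_snd
    exact hR.comp_continuous (continuousOn_heavy.comp_continuous hFc hFy)
      fun y => (hGh' _ (hFy y)).1 y.2.2
  refine ⟨W ∩ F ⁻¹' Gh, hF.isOpen_inter_preimage hW hGh, hWGh,
    ⟨fun y => ⟨e ⟨ρ (F y), hρmem _ (hFP y.2.1)⟩, mem_range_self _⟩, ?_⟩, ?_⟩
  · exact (he.continuous.comp (hρc.subtype_mk _)).subtype_mk _
  · rintro ⟨_, μ, rfl⟩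
    refine Subtype.ext (congrArg e (Subtype.ext ?_))
    change ρ (F (e μ)) = μ
    rw [hFe, hρI μ μ.2]

end

theorem theorem3 (X : Type u) [TopologicalSpace X] [MeasurableSpace X] [BorelSpace X]
    (hX : IsARCompactum X ∨ IsANRCompactum X) :
    IsANRCompactum (Pf X) := by
  obtain ⟨hc, hX⟩ : CompactSpace X ∧ IsANR X := by
    rcases hX with ⟨hc, hm, h⟩ | h
    · exact ⟨hc, hm, fun Y _ _ e he => (h Y e he).isNeighborhoodRetract⟩
    · exact h
  have := hX.1
  refine ⟨isCompact_iff_compactSpace.1 isCompact_Pf, ?_⟩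
  rcases isEmpty_or_nonempty X with hemp | hne
  · -- there are no probability measures on the empty space
    have : IsEmpty (Pf X) := ⟨fun μ => hemp.elim (heavy (μ : ProbabilityMeasure X))⟩
    refine ⟨inferInstance, fun Y _ _ e _ => ?_⟩
    have h : Set.range e = ∅ := Set.range_eq_empty e
    refine ⟨∅, isOpen_empty, h.subset, ⟨fun y => y.2.elim, ?_⟩, fun a => ?_⟩
    · exact continuous_of_const fun y => y.2.elim
    · exact (h.subset a.2).elim
  · exact isANR_Pf hX
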